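/- **Setting.** Fix a horizon of $T$ time steps. *Logistics system.* A finite graph of zones with a depot $O$, a set of charging zones (containing $O$) and a set of delivery zones; battery capacity $r_{\max}$, maximal number of delivery stops $n_{\max}$, charging rate $\phi\in\mathbb{Z}_{>0}$, fleet size $\mathcal Q>0$, penalty $\rho>0$. Each e-truck is a Markov decision process with states $s=(t,v,r,n,\tau)$ (time, zone, state of charge $0\le r\le r_{\max}$, remaining deliveries $0\le n\le n_{\max}$, remaining charging time $\tau\le T-t$), starting at $s_0=(0,O,r_{\max},n_{\max},0)$. At $t=T-1$ the truck idles if $v=O$ and $r=r_{\max}$, and otherwise teleports to the depot. At $t<T-1$ it can only keep charging (action "idle") if $\tau>0$; if $\tau=0$ it may idle, deliver (if $r,n>0$ in a delivery zone), start a charging $(\delta_r,\delta_\tau)$ (in a charging zone, with $\delta_r=\phi\delta_\tau$, $\delta_\tau\ge1$, $r+\delta_r\le r_{\max}$, $t+\delta_\tau\le T-1$), or move to an adjacent zone (if $r>0$). Transitions are deterministic: a delivery lowers $r$ and $n$ by $1$; a move lowers $r$ by $1$ and resets $n$ to $n_{\max}$ on arrival at $O$; starting a charging sets $r\to r+\delta_r$,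 $\tau\to\delta_\tau-1$; keeping charging lowers $\tau$ by $1$; teleporting leads to $(O,r_{\max},n_{\max},0)$. The reward $u=u(\mu_D,\mu_C)$ has entries $\mu_D$ on delivery actions, $\mu_C$ on charging actions (starting or keeping charging), $-\rho$ on teleporting, and $0$ otherwise. A policy $\pi$ assigns to each state a point of the open simplex over its feasible actions, and an optimal policy maximizes $\mathbb E[\sum_{t<T}u(s_t,a_t)-F_{s_t}(\pi(\cdot|s_t))\mid s_0]$, where each $F_s$ is essentially smooth and essentially strictly convex on the open simplex over the feasible actions of $s$. The optimal action flow is $x(a|s)=\mathcal Q\,\Pr(s\text{ is visited})\,\pi(a|s)$ for an optimal $\pi$; $x_D,x_C,x_L$ are its delivery, charging and teleporting parts. Each time step belongs to one of $K$ delivery slots, and the station of each charging zone is fed by a load bus of the power grid. $N$ and $M$ are the $0$-$1$ incidence matrices between (slot, delivery zone) pairs and delivery actions, and between (time, load bus) pairs and charging actions. The demand function $D$ is a bijection from a set of delivery price vectors (for instance all of them) onto $\mathbb R^{d}$, with $d$ the number of (slot, delivery zone) pairs; $D^{-1}$ is differentiable at every $z\ge0$, and the revenue $z\mapsto D^{-1}(z)^\top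 z$ is concave on $\{z\ge 0\}$. Let $H(x)=\sum_s \big(\sum_a x(a|s)\big)F_s\big(x(\cdot|s)/\sum_a x(a|s)\big)$, with states without flow contributing $0$ (this is the linearly homogeneous extension of the $F_s$). Given charging prices $p_C\in\mathbb R^{T\times\text{load buses}}$, optimal rewards are $\mu=(\mu_D,\mu_C)$ such that, with $x$ the optimal action flow under $u(\mu)$ and $z=Nx_D$, $$\mu_D=N^\top[\nabla D^{-1}(z)\,z+D^{-1}(z)],\qquad \mu_C=-M^\top p_C,$$ where $\nabla D^{-1}(z)$ is the matrix with $(i,j)$ entry $\partial (D^{-1})_j/\partial z_i$, and such that $x$ maximizes $D^{-1}(Nx_D)^\top Nx_D-p_C^\top Mx_C-\rho\mathbf 1^\top x_L-H(x)$ over the nonnegative flow-conserving $x$ in the domain of $H$. Let $x_C^*(p_C)$ be the charging part of this $x$. *Power grid.* Generator buses, load buses, branches, bus-branch incidence matrix $A$, $B=\mathrm{diag}(b)$ with $b>0$, cost coefficients $c_1,c_2>0$, generation limits $\underline g,\overline g$, line limits $\underline f,\overline f$, base loads $l_0$, and a generator bus as slack bus. With $l=l_0+\phi Mx_C$, the DC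 optimal power flow (DC-OPF) problem is to minimize $\sum_t\sum_i (c_{2,i}g_{t,i}^2+c_{1,i}g_{t,i})$ over $(g,\theta)$ subject to, for all $t$, $ABA^\top\theta_t=(g_t,-l_t)$, $\theta_{\mathrm{slack},t}=0$, $\underline g\le g_t\le\overline g$, $\underline f\le BA^\top\theta_t\le\overline f$. The locational marginal prices $\lambda_l^*(x_C)$ are the optimal dual variables (Lagrangian: cost $+\lambda^\top(ABA^\top\theta-(g,-l))+\dots$) of the balance constraints at the load buses. **Statement.** Let $\Pi\subseteq\mathbb R^{T\times\text{load buses}}$ be nonempty, compact and convex. Suppose that for every $p_C\in\Pi$ the charging flow $x_C^*(p_C)$ has an open neighborhood $X$ on which the DC-OPF problem is feasible and the set of constraints active at the optimum (equalities included) does not change and is linearly independent, and that $h(p_C):=\lambda_l^*(x_C^*(p_C))$ lies in $\Pi$ for every $p_C\in\Pi$. Then $h:\Pi\to\Pi$ is well defined (for each $p_C\in\Pi$, $h(p_C)$ exists and is unique), and there exists $p_C^*\in\Pi$ with $p_C^*=h(p_C^*)=\lambda_l^*(x_C^*(p_C^*))$. -/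

import Mathlib

namespace EloPso

/-! ### Perturbations on the open probability simplex -/

/-- The relative interior of the probability simplex over a finite set `α`. -/
def openSimplex (α : Type*) [Fintype α] : Set (α → ℝ) :=
  {x | (∀ a, 0 < x a) ∧ ∑ a, x a = 1}

/-- A real function on the open simplex that is essentially strictly convex and essentially smooth,
relative to the affine hull of the simplex: strictly convex, differentiable, and with a tangential
gradient whose norm tends to infinity at every point of the relative boundary.
Only the values of `F` on the open simplex matter. -/
structure IsPerturbation {α : Type*} [Fintype α] (F : (α → ℝ) → ℝ) : Prop where
  strictConvexOn : StrictConvexOn ℝ (openSimplex α) F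
  differentiableOn : DifferentiableOn ℝ F (openSimplex α)
  steep : ∀ x₀ ∈ stdSimplex ℝ α, (∃ a, x₀ a = 0) → ∀ C : ℝ,
    ∀ᶠ x in nhdsWithin x₀ (openSimplex α),
      ∃ v : α → ℝ, ∑ a, v a = 0 ∧ ‖v‖ ≤ 1 ∧ C ≤ lineDeriv ℝ F x v

/-! ### The electrified logistics system -/

/-- The data of the electrified logistics system, over a horizon of `T` time steps. Zones are linked
to the load buses of the power grid by `bus` (only its values at charging zones matter). -/
structure Logistics (T : ℕ) (Zone Load : Type*) where
  /-- the adjacency relation between operation zones -/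
  graph : SimpleGraph Zone
  /-- the depot -/
  depot : Zone
  /-- zones with a charging station -/
  chargeZones : Set Zone
  /-- zones with delivery destinations -/
  deliveryZones : Set Zone
  depot_mem : depot ∈ chargeZones
  /-- battery capacity -/
  rmax : ℕ
  /-- maximal number of delivery stops after leaving the depot -/
  nmax : ℕ
  /-- charging rate -/
  φ : ℕ
  φ_pos : 0 < φ
  /-- fleet size -/
  Q : ℝ
  Q_pos : 0 < Q
  /-- teleport penalty -/
  ρ : ℝ
  ρ_pos : 0 < ρ
  /-- number of delivery time slots -/
  K : ℕ
  /-- the delivery slot that contains a given time step -/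
  slot : Fin T → Fin K
  /-- the load bus that supplies the charging station of a zone -/
  bus : Zone → Load

variable {T : ℕ} {Zone Load Gen Branch : Type*}

/-- A state of an e-truck: current time, location, state of charge, remaining deliveries and
remaining charging time. -/
@[ext] structure State (N : Logistics T Zone Load) where
  time : Fin (T + 1)
  zone : Zone
  soc : Fin (N.rmax + 1)
  left : Fin (N.nmax + 1)
  wait : Fin (T + 1)
  wait_le : (wait : ℕ) + time ≤ T

/-- The five types of actions: idle (or keep charging), deliver, schedule a charging of amount `δr`
that takes `δτ` time steps, move to a zone, teleport to the depot. -/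
inductive Action (N : Logistics T Zone Load) where
  | idle : Action N
  | deliver : Action N
  | charge (δr : Fin (N.rmax + 1)) (δτ : Fin (T + 1)) : Action N
  | move (v : Zone) : Action N
  | teleport : Action N

noncomputable instance [Fintype Zone] (N : Logistics T Zone Load) : Fintype (State N) :=
  Fintype.ofInjective
    (fun s : State N => (s.time, s.zone, s.soc, s.left, s.wait)) (by
      intro s s' h
      simp only [Prod.mk.injEq] at h
      exact State.ext h.1 h.2.1 h.2.2.1 h.2.2.2.1 h.2.2.2.2)

open Classical in
noncomputable instance [Fintype Zone] (N : Logistics T Zone Load) : Fintype (Action N) :=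
  Fintype.ofSurjective
    (fun c : (Unit ⊕ Unit ⊕ Unit) ⊕ (Fin (N.rmax + 1) × Fin (T + 1)) ⊕ Zone =>
      match c with
      | .inl (.inl _) => Action.idle
      | .inl (.inr (.inl _)) => Action.deliver
      | .inl (.inr (.inr _)) => Action.teleport
      | .inr (.inl c) => Action.charge c.1 c.2
      | .inr (.inr v) => Action.move v) (by
      intro a
      cases a with
      | idle => exact ⟨.inl (.inl ()), rfl⟩
      | deliver => exact ⟨.inl (.inr (.inl ())), rfl⟩
      | charge δr δτ => exact ⟨.inr (.inl (δr, δτ)), rfl⟩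
      | move v => exact ⟨.inr (.inr v), rfl⟩
      | teleport => exact ⟨.inl (.inr (.inr ())), rfl⟩)

section Logistics

variable (N : Logistics T Zone Load)

/-- The initial state: at the depot at time `0`, fully charged. -/
def initialState : State N where
  time := 0
  zone := N.depot
  soc := Fin.last _
  left := Fin.last _
  wait := 0
  wait_le := by simp

variable {N}

/-- Feasibility of an action in a state before the last decision time: while a charging is under
way the truck can only keep charging; otherwise it may idle, deliver (with positive state of charge
and remaining deliveries, in a delivery zone), charge (in a charging zone, within the capacity, and
so that the charging ends by time `T - 1`) or move to an adjacent zone (with positive state of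
charge). -/
def FeasibleBefore (s : State N) : Action N → Prop
  | .idle => True
  | .deliver => s.wait = 0 ∧ 0 < s.soc ∧ 0 < s.left ∧ s.zone ∈ N.deliveryZones
  | .charge δr δτ => s.wait = 0 ∧ s.zone ∈ N.chargeZones ∧ 1 ≤ (δτ : ℕ) ∧
      (δr : ℕ) = N.φ * δτ ∧ (s.soc : ℕ) + δr ≤ N.rmax ∧ (s.time : ℕ) + δτ ≤ T - 1
  | .move v => s.wait = 0 ∧ 0 < s.soc ∧ N.graph.Adj s.zone v
  | .teleport => False

/-- Feasibility of an action. At the last decision time `T - 1` the truck idles if it is at the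
depot and fully charged, and teleports otherwise. At time `T` there is no action. -/
def Feasible (s : State N) (a : Action N) : Prop :=
  ((s.time : ℕ) + 1 < T ∧ FeasibleBefore s a) ∨
  ((s.time : ℕ) + 1 = T ∧
    ((s.zone = N.depot ∧ s.soc = Fin.last _ ∧ a = .idle) ∨
     (¬ (s.zone = N.depot ∧ s.soc = Fin.last _) ∧ a = .teleport)))

/-- The set of feasible actions of a state. -/
abbrev Act (s : State N) : Type _ := {a : Action N // Feasible s a}

noncomputable instance [Fintype Zone] (s : State N) : Fintype (Act s) := Fintype.ofFinite _

open Classical in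
/-- `Step s a s'`: action `a` leads from state `s` to state `s'`. For `idle`, the truncated
subtraction covers both idling (`wait = 0`) and charging (`wait > 0`). -/
def Step (s : State N) (a : Action N) (s' : State N) : Prop :=
  (s'.time : ℕ) = s.time + 1 ∧
  match a with
  | .idle => s'.zone = s.zone ∧ s'.soc = s.soc ∧ s'.left = s.left ∧ (s'.wait : ℕ) = s.wait - 1
  | .deliver => s'.zone = s.zone ∧ (s'.soc : ℕ) + 1 = s.soc ∧ (s'.left : ℕ) + 1 = s.left ∧
      s'.wait = s.wait
  | .charge δr δτ => s'.zone = s.zone ∧ (s'.soc : ℕ) = s.soc + δr ∧ s'.left = s.left ∧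
      (s'.wait : ℕ) + 1 = δτ
  | .move v => s'.zone = v ∧ (s'.soc : ℕ) + 1 = s.soc ∧
      s'.left = (if v = N.depot then Fin.last _ else s.left) ∧ s'.wait = s.wait
  | .teleport => s'.zone = N.depot ∧ s'.soc = Fin.last _ ∧ s'.left = Fin.last _ ∧ s'.wait = 0

open Classical in
/-- The (deterministic) transition probabilities. -/
noncomputable def transProb (s : State N) (a : Act s) (s' : State N) : ℝ :=
  if Step s a.1 s' then 1 else 0

variable (N) in
/-- Functions on state-action pairs: rewards, policies and action flows. -/
abbrev StateAction : Type _ := (s : State N) → Act s → ℝ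

/-- A policy: in every state before time `T`, a point of the open simplex over the feasible
actions (the domain of the perturbations). -/
def IsPolicy [Fintype Zone] (π : StateAction N) : Prop :=
  ∀ s : State N, (s.time : ℕ) < T → π s ∈ openSimplex (Act s)

open Classical in
/-- `visitProb π k s` is the probability that the controlled chain that starts in the initial state
and follows the policy `π` is in state `s` at time `k`. -/
noncomputable def visitProb [Fintype Zone] (π : StateAction N) : ℕ → State N → ℝ
  | 0, s => if s = initialState N then 1 else 0
  | k + 1, s' => ∑ s : State N, ∑ a : Act s, visitProb π k s * π s a * transProb s a s'

/-- The value of a policy in the initial state: the expectation of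
`∑_{t < T} (u(s_t, a_t) - F_{s_t}(π(·|s_t)))`, written through the laws of `(s_t, a_t)`. -/
noncomputable def value [Fintype Zone] (F : (s : State N) → (Act s → ℝ) → ℝ)
    (u π : StateAction N) : ℝ :=
  ∑ k ∈ Finset.range T, ∑ s : State N,
    visitProb π k s * (∑ a : Act s, π s a * u s a - F s (π s))

/-- Optimality of a policy for the perturbed utility Markov decision process with reward `u`. -/
def IsOptimalPolicy [Fintype Zone] (F : (s : State N) → (Act s → ℝ) → ℝ)
    (u π : StateAction N) : Prop :=
  IsPolicy π ∧ ∀ π', IsPolicy π' → value F u π' ≤ value F u π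

/-- The action flows of the fleet under a policy. -/
noncomputable def policyFlow [Fintype Zone] (π : StateAction N) : StateAction N :=
  fun s a => N.Q * visitProb π s.time s * π s a

/-- The optimal action flows at reward `u`: the flows under an optimal policy. -/
def IsOptimalFlow [Fintype Zone] (F : (s : State N) → (Act s → ℝ) → ℝ)
    (u x : StateAction N) : Prop :=
  ∃ π, IsOptimalPolicy F u π ∧ x = policyFlow π

/-- A charging action: scheduling a charging, or keeping on charging. -/
def IsCharging (s : State N) (a : Action N) : Prop :=
  (∃ δr δτ, a = .charge δr δτ) ∨ (s.wait ≠ 0 ∧ a = .idle)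

variable (N) in
/-- The index set of delivery flows and delivery rewards. -/
abbrev DeliveryAction : Type _ := {c : (s : State N) × Act s // c.2.1 = Action.deliver}

variable (N) in
/-- The index set of charging flows and charging rewards. -/
abbrev ChargingAction : Type _ := {c : (s : State N) × Act s // IsCharging c.1 c.2.1}

noncomputable instance [Fintype Zone] : Fintype (DeliveryAction N) := Fintype.ofFinite _
noncomputable instance [Fintype Zone] : Fintype (ChargingAction N) := Fintype.ofFinite _

/-- The delivery part of an action flow. -/
def deliveryFlow (x : StateAction N) : DeliveryAction N → ℝ := fun c => x c.1.1 c.1.2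

/-- The charging part of an action flow. -/
def chargingFlow (x : StateAction N) : ChargingAction N → ℝ := fun c => x c.1.1 c.1.2

open Classical in
/-- The total teleporting flow. -/
noncomputable def teleportFlow [Fintype Zone] (x : StateAction N) : ℝ :=
  ∑ s : State N, ∑ a : Act s, if a.1 = Action.teleport then x s a else 0

open Classical in
/-- The reward of the decision process determined by delivery and charging rewards. -/
noncomputable def reward (μD : DeliveryAction N → ℝ) (μC : ChargingAction N → ℝ) :
    StateAction N := fun s a =>
  if h : a.1 = Action.deliver then μD ⟨⟨s, a⟩, h⟩
  else if h : IsCharging s a.1 then μC ⟨⟨s, a⟩, h⟩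
  else if a.1 = Action.teleport then -N.ρ
  else 0

variable (N) in
/-- The index set of delivery demands and delivery fees: time slots and delivery zones. -/
abbrev DemandIndex : Type _ := Fin N.K × N.deliveryZones

noncomputable instance [Fintype Zone] : Fintype (DemandIndex N) := Fintype.ofFinite _

open Classical in
variable (N) in
/-- The incidence matrix between load buses (at each time) and charging actions. -/
noncomputable def chargeIncidence : Matrix (Fin T × Load) (ChargingAction N) ℝ :=
  Matrix.of fun i c =>
    if (i.1 : ℕ) = c.1.1.time ∧ i.2 = N.bus c.1.1.zone then 1 else 0

open Classical in
variable (N) in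
/-- The incidence matrix between delivery demands and delivery actions. -/
noncomputable def deliveryIncidence : Matrix (DemandIndex N) (DeliveryAction N) ℝ :=
  Matrix.of fun i c =>
    if (∃ t : Fin T, (t : ℕ) = c.1.1.time ∧ N.slot t = i.1) ∧ (i.2 : Zone) = c.1.1.zone
    then 1 else 0

/-- The delivery demand that an action flow serves. -/
noncomputable def servedDemand [Fintype Zone] (x : StateAction N) : DemandIndex N → ℝ :=
  (deliveryIncidence N).mulVec (deliveryFlow x)

/-- The total flow through a state. -/
noncomputable def stateFlow [Fintype Zone] (x : StateAction N) (s : State N) : ℝ :=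
  ∑ a : Act s, x s a

/-- The perturbation term of the operator's problem. States without flow contribute `0`. -/
noncomputable def flowPerturbation [Fintype Zone] (F : (s : State N) → (Act s → ℝ) → ℝ)
    (x : StateAction N) : ℝ :=
  ∑ s : State N, stateFlow x s * F s (fun a => x s a / stateFlow x s)

open Classical in
/-- Feasible action flows: nonnegative, and conserved in every state before time `T`, with all of
the fleet entering at the initial state. -/
def IsFeasibleFlow [Fintype Zone] (x : StateAction N) : Prop :=
  (∀ s a, 0 ≤ x s a) ∧
  ∀ s' : State N, (s'.time : ℕ) < T →
    stateFlow x s' - ∑ s : State N, ∑ a : Act s, x s a * transProb s a s' =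
      if s' = initialState N then N.Q else 0

/-- The feasible flows at which the perturbation term is finite: in every state that carries flow,
the normalized flow lies in the open simplex, the domain of the perturbation of that state. -/
def InFlowDomain [Fintype Zone] (x : StateAction N) : Prop :=
  IsFeasibleFlow x ∧ ∀ s, 0 < stateFlow x s → ∀ a, 0 < x s a

/-- The operator's profit at charging prices `p`, reduced to the action flows; `D` maps delivery
fees to demands. -/
noncomputable def profit [Fintype Zone] [Fintype Load]
    (F : (s : State N) → (Act s → ℝ) → ℝ)
    (D : PartialEquiv (DemandIndex N → ℝ) (DemandIndex N → ℝ))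
    (p : Fin T × Load → ℝ) (x : StateAction N) : ℝ :=
  D.symm (servedDemand x) ⬝ᵥ servedDemand x
    - p ⬝ᵥ (chargeIncidence N).mulVec (chargingFlow x)
    - N.ρ * teleportFlow x - flowPerturbation F x

/-- The action flow `x` solves the operator's centralized profit maximization problem. -/
def IsSystemOptimal [Fintype Zone] [Fintype Load]
    (F : (s : State N) → (Act s → ℝ) → ℝ)
    (D : PartialEquiv (DemandIndex N → ℝ) (DemandIndex N → ℝ))
    (p : Fin T × Load → ℝ) (x : StateAction N) : Prop :=
  InFlowDomain x ∧ ∀ y, InFlowDomain y → profit F D p y ≤ profit F D p x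

open Classical in
/-- The gradient matrix `(∂ f_j / ∂ z_i)_{i j}` of a vector field. -/
noncomputable def gradMatrix {ι : Type*} [Fintype ι] (f : (ι → ℝ) → ι → ℝ) (z : ι → ℝ) :
    Matrix ι ι ℝ :=
  Matrix.of fun i j => fderiv ℝ f z (Pi.single i 1) j

/-- `(μD, μC)` are optimal rewards at charging prices `p`, and `x` are the optimal action flows of
the e-trucks under these rewards: the rewards solve the fixed-point equations and make the
decentralized operations `x` system optimal. -/
structure IsOptimalReward [Fintype Zone] [Fintype Load]
    (F : (s : State N) → (Act s → ℝ) → ℝ)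
    (D : PartialEquiv (DemandIndex N → ℝ) (DemandIndex N → ℝ))
    (p : Fin T × Load → ℝ) (μD : DeliveryAction N → ℝ) (μC : ChargingAction N → ℝ)
    (x : StateAction N) : Prop where
  flow : IsOptimalFlow F (reward μD μC) x
  delivery : μD = (deliveryIncidence N).transpose.mulVec
    ((gradMatrix D.symm (servedDemand x)).mulVec (servedDemand x) + D.symm (servedDemand x))
  charging : μC = -(chargeIncidence N).transpose.mulVec p
  systemOptimal : IsSystemOptimal F D p x

/-- `xC` is the optimal charging flow at charging prices `p`. -/
def IsOptimalChargingFlow [Fintype Zone] [Fintype Load]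
    (F : (s : State N) → (Act s → ℝ) → ℝ)
    (D : PartialEquiv (DemandIndex N → ℝ) (DemandIndex N → ℝ))
    (p : Fin T × Load → ℝ) (xC : ChargingAction N → ℝ) : Prop :=
  ∃ μD μC x, IsOptimalReward F D p μD μC x ∧ xC = chargingFlow x

end Logistics

/-! ### The power grid and the DC optimal power flow problem -/

/-- The data of the power grid. Its buses are the generator buses `Gen` and the load buses
`Load`; `slack` is the slack bus. -/
structure Grid (T : ℕ) (Gen Load Branch : Type*) where
  src : Branch → Gen ⊕ Load
  dst : Branch → Gen ⊕ Load
  src_ne_dst : ∀ e, src e ≠ dst e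
  slack : Gen
  /-- susceptances -/
  b : Branch → ℝ
  b_pos : ∀ e, 0 < b e
  /-- quadratic and linear cost coefficients -/
  c₂ : Gen → ℝ
  c₂_pos : ∀ i, 0 < c₂ i
  c₁ : Gen → ℝ
  c₁_pos : ∀ i, 0 < c₁ i
  /-- generation limits -/
  gmin : Gen → ℝ
  gmax : Gen → ℝ
  /-- line capacity limits -/
  fmin : Branch → ℝ
  fmax : Branch → ℝ
  /-- base loads -/
  l₀ : Fin T × Load → ℝ

section Grid

variable (P : Grid T Gen Load Branch)

open Classical in
/-- The bus-branch incidence matrix. -/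
noncomputable def busBranch : Matrix (Gen ⊕ Load) Branch ℝ :=
  Matrix.of fun v e => if v = P.src e then 1 else if v = P.dst e then -1 else 0

open Classical in
/-- The matrix `B Aᵀ`, which maps voltage angles to line flows. -/
noncomputable def flowMatrix [Fintype Branch] : Matrix Branch (Gen ⊕ Load) ℝ :=
  Matrix.diagonal P.b * (busBranch P).transpose

/-- Primal variables: generations and voltage angles at each time. -/
abbrev Primal (T : ℕ) (Gen Load : Type*) : Type _ :=
  (Fin T → Gen → ℝ) × (Fin T → Gen ⊕ Load → ℝ)

/-- The generation cost. -/
def cost [Fintype Gen] (z : Primal T Gen Load) : ℝ :=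
  ∑ t, ∑ i, (P.c₂ i * z.1 t i ^ 2 + P.c₁ i * z.1 t i)

/-- The scalar constraints of the problem: power balance at each bus and slack angle (equalities),
upper and lower generation limits, upper and lower line limits (inequalities). -/
inductive Constraint (T : ℕ) (Gen Load Branch : Type*) where
  | balance (t : Fin T) (v : Gen ⊕ Load) : Constraint T Gen Load Branch
  | slack (t : Fin T) : Constraint T Gen Load Branch
  | genUpper (t : Fin T) (i : Gen) : Constraint T Gen Load Branch
  | genLower (t : Fin T) (i : Gen) : Constraint T Gen Load Branch
  | lineUpper (t : Fin T) (e : Branch) : Constraint T Gen Load Branch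
  | lineLower (t : Fin T) (e : Branch) : Constraint T Gen Load Branch

open Classical in
noncomputable instance [Fintype Gen] [Fintype Load] [Fintype Branch] :
    Fintype (Constraint T Gen Load Branch) :=
  Fintype.ofSurjective
    (fun c : Fin T × ((Gen ⊕ Load) ⊕ Unit ⊕ (Gen ⊕ Gen) ⊕ (Branch ⊕ Branch)) =>
      match c with
      | (t, .inl v) => Constraint.balance t v
      | (t, .inr (.inl _)) => Constraint.slack t
      | (t, .inr (.inr (.inl (.inl i)))) => Constraint.genUpper t i
      | (t, .inr (.inr (.inl (.inr i)))) => Constraint.genLower t i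
      | (t, .inr (.inr (.inr (.inl e)))) => Constraint.lineUpper t e
      | (t, .inr (.inr (.inr (.inr e)))) => Constraint.lineLower t e) (by
      intro c
      cases c with
      | balance t v => exact ⟨(t, .inl v), rfl⟩
      | slack t => exact ⟨(t, .inr (.inl ())), rfl⟩
      | genUpper t i => exact ⟨(t, .inr (.inr (.inl (.inl i)))), rfl⟩
      | genLower t i => exact ⟨(t, .inr (.inr (.inl (.inr i)))), rfl⟩
      | lineUpper t e => exact ⟨(t, .inr (.inr (.inr (.inl e)))), rfl⟩
      | lineLower t e => exact ⟨(t, .inr (.inr (.inr (.inr e)))), rfl⟩)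

/-- The equality constraints. -/
def Constraint.IsEquality : Constraint T Gen Load Branch → Prop
  | .balance _ _ => True
  | .slack _ => True
  | _ => False

/-- The left-hand side of a constraint written as `lhs = rhs` or `lhs ≤ rhs`. It is linear in the
primal variables, hence also the gradient of the constraint. -/
noncomputable def lhs [Fintype Gen] [Fintype Load] [Fintype Branch] :
    Constraint T Gen Load Branch → Primal T Gen Load → ℝ
  | .balance t v, z => (busBranch P * flowMatrix P).mulVec (z.2 t) v - Sum.elim (z.1 t) 0 v
  | .slack t, z => z.2 t (Sum.inl P.slack)
  | .genUpper t i, z => z.1 t i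
  | .genLower t i, z => -z.1 t i
  | .lineUpper t e, z => (flowMatrix P).mulVec (z.2 t) e
  | .lineLower t e, z => -(flowMatrix P).mulVec (z.2 t) e

/-- The right-hand side of a constraint, for the loads `l`. -/
def rhs (l : Fin T × Load → ℝ) : Constraint T Gen Load Branch → ℝ
  | .balance t v => Sum.elim 0 (fun k => -l (t, k)) v
  | .slack _ => 0
  | .genUpper _ i => P.gmax i
  | .genLower _ i => -P.gmin i
  | .lineUpper _ e => P.fmax e
  | .lineLower _ e => -P.fmin e

variable [Fintype Gen] [Fintype Load] [Fintype Branch]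

/-- Feasibility for the DC optimal power flow problem with loads `l`. -/
def IsFeasible (l : Fin T × Load → ℝ) (z : Primal T Gen Load) : Prop :=
  (∀ c : Constraint T Gen Load Branch, c.IsEquality → lhs P c z = rhs P l c) ∧
  ∀ c : Constraint T Gen Load Branch, ¬ c.IsEquality → lhs P c z ≤ rhs P l c

/-- Optimality for the DC optimal power flow problem with loads `l`. -/
def IsOptimal (l : Fin T × Load → ℝ) (z : Primal T Gen Load) : Prop :=
  IsFeasible P l z ∧ ∀ z', IsFeasible P l z' → cost P z ≤ cost P z'

/-- The constraints (equalities included) that are active at `z`. -/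
def activeSet (l : Fin T × Load → ℝ) (z : Primal T Gen Load) :
    Set (Constraint T Gen Load Branch) :=
  {c | lhs P c z = rhs P l c}

/-- `z` is an optimal primal solution and `y` an optimal dual solution (Lagrange multipliers for the
Lagrangian `cost + ∑ y (lhs - rhs)`): dual feasibility, complementary slackness and stationarity. -/
structure IsPrimalDualOptimal (l : Fin T × Load → ℝ) (z : Primal T Gen Load)
    (y : Constraint T Gen Load Branch → ℝ) : Prop where
  optimal : IsOptimal P l z
  nonneg : ∀ c, ¬ c.IsEquality → 0 ≤ y c
  slackness : ∀ c, y c * (lhs P c z - rhs P l c) = 0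
  stationary : ∀ d : Primal T Gen Load,
    ∑ t, ∑ i, (2 * P.c₂ i * z.1 t i + P.c₁ i) * d.1 t i + ∑ c, y c * lhs P c d = 0

/-- `q` are locational marginal prices at the loads `l`: the optimal dual variables of the power
balance at the load buses. -/
def IsLMP (l q : Fin T × Load → ℝ) : Prop :=
  ∃ z y, IsPrimalDualOptimal P l z y ∧
    ∀ t k, q (t, k) = y (Constraint.balance t (Sum.inr k))

variable [Fintype Zone] {N : Logistics T Zone Load}

/-- The total loads under the charging flow `xC`. -/
noncomputable def totalLoad (xC : ChargingAction N → ℝ) : Fin T × Load → ℝ :=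
  P.l₀ + (N.φ : ℝ) • (chargeIncidence N).mulVec xC

/-- On some open neighborhood of `xC` the problem is feasible, and the set of constraints that are
active at the optimum does not change and consists of linearly independent constraints. -/
def IsRegularAt (xC : ChargingAction N → ℝ) : Prop :=
  ∃ X : Set (ChargingAction N → ℝ), IsOpen X ∧ xC ∈ X ∧
    ∃ S : Set (Constraint T Gen Load Branch),
      LinearIndependent ℝ (fun c : S => lhs P c.1) ∧
      ∀ x' ∈ X, (∃ z, IsFeasible P (totalLoad P x') z) ∧
        ∀ z, IsOptimal P (totalLoad P x') z → activeSet P (totalLoad P x') z = S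

/-- The graph of the map `h = λ_l* ∘ x_C*`: `q` are the locational marginal prices at the optimal
charging flow for the charging prices `p`. -/
def IsPriceResponse (F : (s : State N) → (Act s → ℝ) → ℝ)
    (D : PartialEquiv (DemandIndex N → ℝ) (DemandIndex N → ℝ))
    (p q : Fin T × Load → ℝ) : Prop :=
  ∃ xC : ChargingAction N → ℝ, IsOptimalChargingFlow F D p xC ∧ IsLMP P (totalLoad P xC) q

end Grid

end EloPso

open Filter Topology

namespace EloPso

/-! ### Perturbations -/

section

/-- Tangent planes lie below the graph of a convex function. -/
theorem _root_.ConvexOn.add_fderivWithin_le {E : Type*} [NormedAddCommGroup E] [NormedSpace ℝ E]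
    {S : Set E} {f : E → ℝ} {L : E →L[ℝ] ℝ} {x y : E} (hf : ConvexOn ℝ S f)
    (hL : HasFDerivWithinAt f L S x) (hx : x ∈ S) (hy : y ∈ S) : f x + L (y - x) ≤ f y := by
  have hline : ∀ t ∈ Set.Icc (0 : ℝ) 1, x + t • (y - x) ∈ S := fun t ht => by
    have := hf.1 hx hy (sub_nonneg.2 ht.2) ht.1 (by ring)
    convert this using 1
    module
  have hg : HasDerivWithinAt (fun t : ℝ => f (x + t • (y - x))) (L (y - x)) (Set.Icc 0 1) 0 := by
    have h1 : HasDerivWithinAt (fun t : ℝ => x + t • (y - x)) (y - x) (Set.Icc 0 1) 0 := by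
      simpa using ((hasDerivWithinAt_id (0 : ℝ) (Set.Icc 0 1)).smul_const (y - x)).const_add x
    have h2 : HasFDerivWithinAt f L S (x + (0 : ℝ) • (y - x)) := by simpa using hL
    exact h2.comp_hasDerivWithinAt (0 : ℝ) h1 hline
  have hg' := hasDerivWithinAt_iff_tendsto_slope.1 hg
  have hset : Set.Icc (0 : ℝ) 1 \ {0} = Set.Ioc 0 1 := by
    ext t; simp only [Set.mem_sdiff, Set.mem_Icc, Set.mem_singleton_iff, Set.mem_Ioc]
    constructor
    · rintro ⟨⟨h0, h1⟩, h2⟩; exact ⟨lt_of_le_of_ne h0 (Ne.symm h2), h1⟩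
    · rintro ⟨h0, h1⟩; exact ⟨⟨h0.le, h1⟩, h0.ne'⟩
  rw [hset] at hg'
  have : (𝓝[Set.Ioc (0 : ℝ) 1] 0).NeBot := by
    rw [nhdsWithin_Ioc_eq_nhdsGT zero_lt_one]; infer_instance
  have hle : L (y - x) ≤ f y - f x := by
    refine le_of_tendsto hg' ?_
    filter_upwards [self_mem_nhdsWithin] with t ht
    have := hf.2 hx hy (sub_nonneg.2 ht.2) ht.1.le (by ring)
    have he : (1 - t) • x + t • y = x + t • (y - x) := by module
    rw [he] at this
    simp only [smul_eq_mul] at this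
    simp only [slope, sub_zero, zero_smul, add_zero, vsub_eq_sub, smul_eq_mul]
    rw [inv_mul_le_iff₀ ht.1]
    linarith
  linarith

variable {α : Type*} [Fintype α]

theorem openSimplex_subset_stdSimplex : openSimplex α ⊆ stdSimplex ℝ α :=
  fun _ hx => ⟨fun a => (hx.1 a).le, hx.2⟩

/-- A tangential line through a point of the open simplex stays in it for small times of both signs,
so the derivative within the simplex is a genuine two-sided derivative along the line. This links
the steepness condition to `fderivWithin`. -/
theorem lineDeriv_eq_of_hasFDerivWithinAt {F : (α → ℝ) → ℝ} {L : (α → ℝ) →L[ℝ] ℝ} {x v : α → ℝ}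
    (hx : x ∈ openSimplex α) (hv : ∑ a, v a = 0)
    (hL : HasFDerivWithinAt F L (openSimplex α) x) : lineDeriv ℝ F x v = L v := by
  have h1 : HasDerivWithinAt (fun t : ℝ => x + t • v) v
      ((fun t : ℝ => x + t • v) ⁻¹' openSimplex α) 0 := by
    simpa using ((hasDerivWithinAt_id (0 : ℝ) _).smul_const v).const_add x
  have h2 : HasFDerivWithinAt F L (openSimplex α) (x + (0 : ℝ) • v) := by simpa using hL
  have h3 := h2.comp_hasDerivWithinAt (0 : ℝ) h1 (fun t ht => ht)
  refine (h3.hasDerivAt ?_).deriv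
  have hpos : ∀ᶠ t : ℝ in 𝓝 0, ∀ a, 0 < (x + t • v) a := by
    rw [eventually_all]
    intro a
    have hc : Continuous fun t : ℝ => (x + t • v) a := by
      simp only [Pi.add_apply, Pi.smul_apply]; fun_prop
    exact hc.continuousAt.eventually_const_lt (by simpa using hx.1 a)
  filter_upwards [hpos] with t ht
  refine ⟨ht, ?_⟩
  simp [Finset.sum_add_distrib, ← Finset.mul_sum, hx.2, hv]

variable {F : (α → ℝ) → ℝ}

theorem IsPerturbation.continuousOn (hF : IsPerturbation F) : ContinuousOn F (openSimplex α) :=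
  hF.differentiableOn.continuousOn

/-- One tangent plane lies below `F`, and an affine function is bounded on the compact closed
simplex. -/
theorem IsPerturbation.exists_lower_bound (hF : IsPerturbation F) :
    ∃ m, ∀ x ∈ openSimplex α, m ≤ F x := by
  rcases (openSimplex α).eq_empty_or_nonempty with h | ⟨w, hw⟩
  · exact ⟨0, by simp [h]⟩
  have hL := (hF.differentiableOn w hw).hasFDerivWithinAt
  set L := fderivWithin ℝ F (openSimplex α) w
  have hc : ContinuousOn (fun x => F w + L (x - w)) (stdSimplex ℝ α) := by fun_prop
  obtain ⟨m, hm⟩ := (isCompact_stdSimplex ℝ α).bddBelow_image hc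
  refine ⟨m, fun x hx => ?_⟩
  exact (hm ⟨x, openSimplex_subset_stdSimplex hx, rfl⟩).trans
    (hF.strictConvexOn.convexOn.add_fderivWithin_le hL hw hx)

/-- Near a boundary point of the simplex, the tangents of a perturbation have arbitrarily small
values at a fixed interior point. -/
theorem IsPerturbation.eventually_tangent_le (hF : IsPerturbation F) {x₀ w : α → ℝ}
    (hx₀ : x₀ ∈ stdSimplex ℝ α) (h0 : ∃ a, x₀ a = 0) (hw : w ∈ openSimplex α) (C : ℝ) :
    ∀ᶠ x in 𝓝[openSimplex α] x₀,
      F x + fderivWithin ℝ F (openSimplex α) x (w - x) ≤ -C := by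
  -- A uniform margin `ε` keeps the whole tangential ball of radius `ε` around `w` inside the open
  -- simplex.
  have hpos : ∃ ε > 0, ∀ a, ε < w a := by
    obtain ⟨a₀, -⟩ := h0
    obtain ⟨b, -, hb⟩ := Finset.exists_min_image Finset.univ w ⟨a₀, Finset.mem_univ _⟩
    exact ⟨w b / 2, by have := hw.1 b; positivity, fun a => by
      have := hw.1 b; have := hb a (Finset.mem_univ _); linarith⟩
  obtain ⟨ε, hε, hεw⟩ := hpos
  have hmem : ∀ v : α → ℝ, ∑ a, v a = 0 → ‖v‖ ≤ 1 → w + ε • v ∈ openSimplex α := by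
    refine fun v hv hv1 => ⟨fun a => ?_, ?_⟩
    · have h1 : |v a| ≤ 1 := (norm_le_pi_norm v a).trans hv1
      have h2 := (abs_le.1 h1).1
      have h3 := hεw a
      simp only [Pi.add_apply, Pi.smul_apply, smul_eq_mul]
      nlinarith
    · simp [Finset.sum_add_distrib, ← Finset.mul_sum, hw.2, hv]
  set V : Set (α → ℝ) := {v | ∑ a, v a = 0} ∩ Metric.closedBall 0 1
  have hVc : IsCompact V := by
    refine (isCompact_closedBall (0 : α → ℝ) 1).inter_left ?_
    exact isClosed_eq (by fun_prop) continuous_const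
  have hVS : ∀ v ∈ V, w + ε • v ∈ openSimplex α := fun v hv =>
    hmem v hv.1 (by simpa using hv.2)
  have hcont : ContinuousOn (fun v => F (w + ε • v)) V :=
    hF.continuousOn.comp (by fun_prop) hVS
  obtain ⟨M, hM⟩ := hVc.bddAbove_image hcont
  -- The slope `(M + C) / ε` is chosen so that the step `ε • v` adds at least `M + C` to the tangent
  -- plane. That plane is still at most `M` at `w + ε • v`, hence at most `-C` at `w`.
  filter_upwards [hF.steep x₀ hx₀ h0 ((M + C) / ε), self_mem_nhdsWithin] with x hx hxS
  obtain ⟨v, hv, hv1, hvC⟩ := hx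
  have hL := (hF.differentiableOn x hxS).hasFDerivWithinAt
  rw [lineDeriv_eq_of_hasFDerivWithinAt hxS hv hL] at hvC
  set L := fderivWithin ℝ F (openSimplex α) x
  have h1 := hF.strictConvexOn.convexOn.add_fderivWithin_le hL hxS (hmem v hv hv1)
  have h2 : F (w + ε • v) ≤ M := hM ⟨v, ⟨hv, by simpa using hv1⟩, rfl⟩
  have h3 : w + ε • v - x = (w - x) + ε • v := by abel
  rw [h3, map_add, map_smul, smul_eq_mul] at h1
  rw [div_le_iff₀ hε] at hvC
  linarith

/-- The tangent plane at `x` is below `F ξ` at `ξ` and below `-C` at `w`. Averaging with the weights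
that represent `x` cancels the linear terms. -/
theorem IsPerturbation.eventually_le_of_eq_combination (hF : IsPerturbation F) {x₀ w : α → ℝ}
    (hx₀ : x₀ ∈ stdSimplex ℝ α) (h0 : ∃ a, x₀ a = 0) (hw : w ∈ openSimplex α) (C : ℝ) :
    ∀ᶠ x in 𝓝[openSimplex α] x₀, ∀ ξ ∈ openSimplex α, ∀ t : ℝ, 0 ≤ t → t ≤ 1 →
      x = (1 - t) • ξ + t • w → F x ≤ (1 - t) * F ξ - t * C := by
  filter_upwards [hF.eventually_tangent_le hx₀ h0 hw C, self_mem_nhdsWithin] with x hx hxS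
    ξ hξ t ht0 ht1 hxe
  have hL := (hF.differentiableOn x hxS).hasFDerivWithinAt
  have h1 := hF.strictConvexOn.convexOn.add_fderivWithin_le hL hxS hξ
  set L := fderivWithin ℝ F (openSimplex α) x
  have h2 : (1 - t) * L (ξ - x) + t * L (w - x) = 0 := by
    rw [← smul_eq_mul, ← smul_eq_mul, ← map_smul, ← map_smul, ← map_add]
    rw [show (1 - t) • (ξ - x) + t • (w - x) = ((1 - t) • ξ + t • w) - x by module, ← hxe,
      sub_self, map_zero]
  have h3 := mul_le_mul_of_nonneg_left h1 (sub_nonneg.2 ht1)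
  have h4 := mul_le_mul_of_nonneg_left hx ht0
  nlinarith

/-! ### Normalization of flows and homogeneous extensions -/

/-- The composition of a vector of flows. -/
noncomputable def normalize (y : α → ℝ) : α → ℝ := fun a => y a / ∑ b, y b

/-- The linearly homogeneous extension of a perturbation. -/
noncomputable def perspective (F : (α → ℝ) → ℝ) (y : α → ℝ) : ℝ := (∑ a, y a) * F (normalize y)

theorem normalize_mem_openSimplex {y : α → ℝ} (hy : ∀ a, 0 < y a) (hs : 0 < ∑ a, y a) :
    normalize y ∈ openSimplex α :=
  ⟨fun a => div_pos (hy a) hs, by simp [normalize, ← Finset.sum_div, hs.ne']⟩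

theorem continuousAt_normalize {x₀ : α → ℝ} (hs : 0 < ∑ a, x₀ a) :
    ContinuousAt (normalize (α := α)) x₀ := by
  rw [continuousAt_pi]
  intro a
  have h : Continuous fun x : α → ℝ => ∑ b, x b := by fun_prop
  exact (continuous_apply a).continuousAt.div h.continuousAt hs.ne'

theorem sum_combination (y w : α → ℝ) (t : ℝ) :
    ∑ a, ((1 - t) • y + t • w) a = (1 - t) * ∑ a, y a + t * ∑ a, w a := by
  simp [Finset.sum_add_distrib, Finset.mul_sum]

theorem sum_combination_pos {y w : α → ℝ} (hy : 0 < ∑ a, y a) (hw : 0 < ∑ a, w a) {t : ℝ}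
    (h0 : 0 ≤ t) (h1 : t ≤ 1) : 0 < ∑ a, ((1 - t) • y + t • w) a := by
  rw [sum_combination]
  rcases h0.eq_or_lt with rfl | h0
  · simpa using hy
  · have := mul_nonneg (sub_nonneg.2 h1) hy.le
    have := mul_pos h0 hw
    linarith

/-- Normalizing a mixture mixes the compositions, but with weights proportional to the total flows
contributed. This reweighting reduces inequalities for the perspective to inequalities for `F` on
the simplex. -/
theorem normalize_combination {y w : α → ℝ} (hy : 0 < ∑ a, y a) (hw : 0 < ∑ a, w a) {t : ℝ}
    (h0 : 0 ≤ t) (h1 : t ≤ 1) :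
    normalize ((1 - t) • y + t • w) =
      (1 - t * (∑ a, w a) / ∑ a, ((1 - t) • y + t • w) a) • normalize y +
        (t * (∑ a, w a) / ∑ a, ((1 - t) • y + t • w) a) • normalize w := by
  have hX := sum_combination_pos hy hw h0 h1
  have hS := sum_combination y w t
  ext a
  simp only [normalize, Pi.add_apply, Pi.smul_apply, smul_eq_mul] at hX hS ⊢
  rw [hS] at hX ⊢
  generalize ∑ a, y a = Y at *
  generalize ∑ a, w a = W at *
  have h2 := hX.ne'
  field_simp
  ring

theorem weight_mem {y w : α → ℝ} (hy : 0 < ∑ a, y a) (hw : 0 < ∑ a, w a) {t : ℝ}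
    (h0 : 0 ≤ t) (h1 : t ≤ 1) :
    0 ≤ t * (∑ a, w a) / ∑ a, ((1 - t) • y + t • w) a ∧
      t * (∑ a, w a) / ∑ a, ((1 - t) • y + t • w) a ≤ 1 := by
  have hX := sum_combination_pos hy hw h0 h1
  refine ⟨div_nonneg (mul_nonneg h0 hw.le) hX.le, (div_le_one hX).2 ?_⟩
  rw [sum_combination]
  have := mul_nonneg (sub_nonneg.2 h1) hy.le
  linarith

theorem IsPerturbation.perspective_combination_le (hF : IsPerturbation F) {y w : α → ℝ}
    (hy : 0 < ∑ a, y a) (hw : 0 < ∑ a, w a) (hy' : ∀ a, 0 < y a) (hw' : ∀ a, 0 < w a) {t : ℝ}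
    (h0 : 0 ≤ t) (h1 : t ≤ 1) :
    perspective F ((1 - t) • y + t • w) ≤ (1 - t) * perspective F y + t * perspective F w := by
  have hX := sum_combination_pos hy hw h0 h1
  obtain ⟨k0, k1⟩ := weight_mem hy hw h0 h1
  have := hF.strictConvexOn.convexOn.2 (normalize_mem_openSimplex hy' hy)
    (normalize_mem_openSimplex hw' hw) (sub_nonneg.2 k1) k0 (by ring)
  unfold perspective
  rw [normalize_combination hy hw h0 h1]
  refine (mul_le_mul_of_nonneg_left this hX.le).trans_eq ?_
  have hS := sum_combination y w t
  generalize ∑ a, ((1 - t) • y + t • w) a = X at *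
  simp only [smul_eq_mul]
  field_simp
  rw [hS]
  ring

/-- Different compositions are essential: the perspective is linear on rays, so strictness only
holds across them. -/
theorem IsPerturbation.perspective_combination_lt (hF : IsPerturbation F) {y w : α → ℝ}
    (hy : 0 < ∑ a, y a) (hw : 0 < ∑ a, w a) (hy' : ∀ a, 0 < y a) (hw' : ∀ a, 0 < w a) {t : ℝ}
    (h0 : 0 < t) (h1 : t < 1) (hne : normalize y ≠ normalize w) :
    perspective F ((1 - t) • y + t • w) < (1 - t) * perspective F y + t * perspective F w := by
  have hX := sum_combination_pos hy hw h0.le h1.le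
  have hS := sum_combination y w t
  have k0 : 0 < t * (∑ a, w a) / ∑ a, ((1 - t) • y + t • w) a := by positivity
  have k1 : t * (∑ a, w a) / ∑ a, ((1 - t) • y + t • w) a < 1 := by
    rw [div_lt_one hX, hS]
    have := mul_pos (sub_pos.2 h1) hy
    linarith
  have := hF.strictConvexOn.2 (normalize_mem_openSimplex hy' hy)
    (normalize_mem_openSimplex hw' hw) hne (sub_pos.2 k1) k0 (by ring)
  unfold perspective
  rw [normalize_combination hy hw h0.le h1.le]
  refine (mul_lt_mul_of_pos_left this hX).trans_eq ?_
  generalize ∑ a, ((1 - t) • y + t • w) a = X at *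
  simp only [smul_eq_mul]
  field_simp
  rw [hS]
  ring

/-- Moving a flow vector towards an interior one reduces the perspective at an arbitrarily high
rate near a boundary point with positive total flow. -/
theorem IsPerturbation.eventually_perspective_le (hF : IsPerturbation F) {x₀ w : α → ℝ}
    (hx₀ : ∀ a, 0 ≤ x₀ a) (hs : 0 < ∑ a, x₀ a) (h0 : ∃ a, x₀ a = 0)
    (hw : ∀ a, 0 < w a) (hws : 0 < ∑ a, w a) (C : ℝ) :
    ∀ᶠ x in 𝓝 x₀, ∀ y : α → ℝ, (∀ a, 0 < y a) → ∀ t : ℝ, 0 ≤ t → t ≤ 1 →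
      x = (1 - t) • y + t • w →
        perspective F x ≤ (1 - t) * perspective F y - t * (∑ a, w a) * C := by
  have hmem : normalize x₀ ∈ stdSimplex ℝ α :=
    ⟨fun a => div_nonneg (hx₀ a) hs.le, by simp [normalize, ← Finset.sum_div, hs.ne']⟩
  have hb : ∃ a, normalize x₀ a = 0 := h0.imp fun a ha => by simp [normalize, ha]
  -- The estimate near `normalize x₀` is pulled back through the continuity of `normalize` at a
  -- point of positive total flow.
  have hev := eventually_nhdsWithin_iff.1 (hF.eventually_le_of_eq_combination hmem hb
    (normalize_mem_openSimplex hw hws) C)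
  have hcont := continuousAt_normalize hs
  filter_upwards [hcont.eventually hev] with x hx y hy t ht0 ht1 hxe
  have : Nonempty α := h0.nonempty
  have hys : 0 < ∑ a, y a := Finset.sum_pos (fun a _ => hy a) Finset.univ_nonempty
  obtain ⟨k0, k1⟩ := weight_mem hys hws ht0 ht1
  have hX := sum_combination_pos hys hws ht0 ht1
  have hxpos : ∀ a, 0 < x a := by
    intro a
    rw [hxe]
    simp only [Pi.add_apply, Pi.smul_apply, smul_eq_mul]
    rcases ht0.eq_or_lt with rfl | ht0
    · simpa using hy a
    · have := mul_nonneg (sub_nonneg.2 ht1) (hy a).le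
      have := mul_pos ht0 (hw a)
      linarith
  have hn := normalize_combination hys hws ht0 ht1
  have hS := sum_combination y w t
  rw [← hxe] at hX hn hS k0 k1
  have h := hx (normalize_mem_openSimplex hxpos hX) _ (normalize_mem_openSimplex hy hys) _ k0 k1 hn
  unfold perspective
  refine (mul_le_mul_of_nonneg_left h hX.le).trans_eq ?_
  generalize ∑ a, x a = X at *
  field_simp
  rw [hS]
  ring

theorem IsPerturbation.continuousAt_perspective (hF : IsPerturbation F) {x₀ : α → ℝ}
    (hx₀ : ∀ a, 0 < x₀ a) (hs : 0 < ∑ a, x₀ a) :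
    ContinuousAt (perspective F) x₀ := by
  have hcont := continuousAt_normalize hs
  have hev : ∀ᶠ x in 𝓝 x₀, normalize x ∈ openSimplex α := by
    have h1 : ∀ᶠ x : α → ℝ in 𝓝 x₀, ∀ a, 0 < x a := by
      rw [eventually_all]
      exact fun a => (continuous_apply a).continuousAt.eventually_const_lt (hx₀ a)
    have h2 : ∀ᶠ x : α → ℝ in 𝓝 x₀, 0 < ∑ a, x a :=
      (by fun_prop : Continuous fun x : α → ℝ => ∑ a, x a).continuousAt.eventually_const_lt hs
    filter_upwards [h1, h2] with x hx hx' using normalize_mem_openSimplex hx hx'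
  have h3 : Tendsto normalize (𝓝 x₀) (𝓝[openSimplex α] (normalize x₀)) :=
    tendsto_nhdsWithin_iff.2 ⟨hcont, hev⟩
  have h4 : Tendsto F (𝓝[openSimplex α] (normalize x₀)) (𝓝 (F (normalize x₀))) :=
    hF.continuousOn _ (normalize_mem_openSimplex hx₀ hs)
  have h5 : Tendsto (fun x : α → ℝ => ∑ a, x a) (𝓝 x₀) (𝓝 (∑ a, x₀ a)) :=
    Continuous.tendsto (by fun_prop) _
  exact h5.mul (h4.comp h3)

end

/-! ### Flows of policies -/

section

variable {T : ℕ} {Zone Load : Type*} {N : Logistics T Zone Load}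

theorem Feasible.time_lt {s : State N} {a : Action N} (h : Feasible s a) : (s.time : ℕ) < T := by
  rcases h with h | h <;> omega

theorem exists_feasible {s : State N} (h : (s.time : ℕ) < T) : Nonempty (Act s) := by
  rcases (Nat.succ_le_of_lt h).lt_or_eq with h | h
  · exact ⟨.idle, Or.inl ⟨h, trivial⟩⟩
  · by_cases hs : s.zone = N.depot ∧ s.soc = Fin.last _
    · exact ⟨.idle, Or.inr ⟨h, Or.inl ⟨hs.1, hs.2, rfl⟩⟩⟩
    · exact ⟨.teleport, Or.inr ⟨h, Or.inr ⟨hs, rfl⟩⟩⟩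

theorem transProb_nonneg (s : State N) (a : Act s) (s' : State N) : 0 ≤ transProb s a s' := by
  unfold transProb; split_ifs <;> norm_num

theorem transProb_le_one (s : State N) (a : Act s) (s' : State N) : transProb s a s' ≤ 1 := by
  unfold transProb; split_ifs <;> norm_num

theorem time_eq_of_transProb_ne_zero {s : State N} {a : Act s} {s' : State N}
    (h : transProb s a s' ≠ 0) : (s'.time : ℕ) = s.time + 1 := by
  unfold transProb at h
  split_ifs at h with hs
  · exact hs.1
  · exact absurd rfl h

variable [Fintype Zone]

/-- The flow that enters a state through transitions. -/
noncomputable def inflow (x : StateAction N) (s' : State N) : ℝ :=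
  ∑ s : State N, ∑ a : Act s, x s a * transProb s a s'

theorem inflow_eq_zero {x : StateAction N} {s : State N} (hs : (s.time : ℕ) = 0) :
    inflow x s = 0 := by
  refine Finset.sum_eq_zero fun r _ => Finset.sum_eq_zero fun a _ => ?_
  by_cases hr : transProb r a s = 0
  · simp [hr]
  · have := time_eq_of_transProb_ne_zero hr; omega

theorem stateFlow_eq_zero_of_le {x : StateAction N} {s : State N} (h : T ≤ (s.time : ℕ)) :
    stateFlow x s = 0 := by
  have : IsEmpty (Act s) := ⟨fun a => by have := a.2.time_lt; omega⟩
  simp [stateFlow]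

open Classical in
theorem IsFeasibleFlow.stateFlow_eq {x : StateAction N} (hx : IsFeasibleFlow x) {s : State N}
    (hs : (s.time : ℕ) < T) :
    stateFlow x s = inflow x s + if s = initialState N then N.Q else 0 := by
  have := hx.2 s hs
  rw [← this]
  simp [inflow]

theorem IsFeasibleFlow.stateFlow_nonneg {x : StateAction N} (hx : IsFeasibleFlow x) (s : State N) :
    0 ≤ stateFlow x s := Finset.sum_nonneg fun a _ => hx.1 s a

theorem IsFeasibleFlow.eq_zero_of_stateFlow_eq_zero {x : StateAction N} (hx : IsFeasibleFlow x)
    {s : State N} (h : stateFlow x s = 0) : x s = 0 := by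
  funext a
  exact (Finset.sum_eq_zero_iff_of_nonneg fun a _ => hx.1 s a).1 h a (Finset.mem_univ _)

theorem le_stateFlow {x : StateAction N} (hx : IsFeasibleFlow x) (s : State N) (a : Act s) :
    x s a ≤ stateFlow x s :=
  Finset.single_le_sum (f := x s) (fun a _ => hx.1 s a) (Finset.mem_univ a)

theorem time_lt_of_stateFlow_pos {x : StateAction N} {s : State N} (h : 0 < stateFlow x s) :
    (s.time : ℕ) < T := by
  by_contra hs
  rw [stateFlow_eq_zero_of_le (not_lt.1 hs)] at h
  exact lt_irrefl _ h

/-! ### Support, bounds and compactness of the flows -/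

/-- All flows in the domain of the perturbation visit the same states. -/
theorem InFlowDomain.stateFlow_pos {x y : StateAction N} (hx : InFlowDomain x)
    (hy : InFlowDomain y) {s : State N} (h : 0 < stateFlow x s) : 0 < stateFlow y s := by
  classical
  induction hk : (s.time : ℕ) generalizing s with
  | zero =>
    have ht := time_lt_of_stateFlow_pos h
    rw [hx.1.stateFlow_eq ht, inflow_eq_zero hk] at h
    rw [hy.1.stateFlow_eq ht, inflow_eq_zero hk]
    exact h
  | succ k ih =>
    have ht := time_lt_of_stateFlow_pos h
    have hne : s ≠ initialState N := by
      rintro rfl; simp [initialState] at hk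
    rw [hx.1.stateFlow_eq ht, if_neg hne, add_zero] at h
    rw [hy.1.stateFlow_eq ht, if_neg hne, add_zero]
    have hyn : ∀ r (a : Act r), 0 ≤ y r a * transProb r a s := fun r a =>
      mul_nonneg (hy.1.1 r a) (transProb_nonneg r a s)
    -- Positive inflow must arrive along some transition from a state `r` visited by `x`. By
    -- induction `y` visits `r` too, and being in the domain it uses every action there.
    obtain ⟨r, -, hr⟩ := Finset.exists_lt_of_sum_lt (s := Finset.univ) (f := fun _ => (0 : ℝ))
      (g := fun r : State N => ∑ a : Act r, x r a * transProb r a s) (by simpa [inflow] using h)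
    obtain ⟨a, -, ha⟩ := Finset.exists_lt_of_sum_lt (s := Finset.univ) (f := fun _ => (0 : ℝ))
      (g := fun a : Act r => x r a * transProb r a s) (by simpa using hr)
    have hta : transProb r a s ≠ 0 := fun h0 => by simp [h0] at ha
    have hxa : 0 < x r a := lt_of_le_of_ne (hx.1.1 r a) fun h0 => by simp [← h0] at ha
    have hyr := ih (hxa.trans_le (le_stateFlow hx.1 r a))
      (by have := time_eq_of_transProb_ne_zero hta; omega)
    have hya : 0 < y r a * transProb r a s :=
      mul_pos (hy.2 r hyr a) (lt_of_le_of_ne (transProb_nonneg r a s) hta.symm)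
    refine Finset.sum_pos' (fun r _ => Finset.sum_nonneg fun a _ => hyn r a)
      ⟨r, Finset.mem_univ _, Finset.sum_pos' (fun a _ => hyn r a) ⟨a, Finset.mem_univ _, hya⟩⟩

/-- A crude induction on time: each of at most `card (State N)` predecessors sends at most its own
flow. Only the existence of a uniform bound matters, for compactness. -/
theorem IsFeasibleFlow.stateFlow_le {x : StateAction N} (hx : IsFeasibleFlow x) (s : State N) :
    stateFlow x s ≤ N.Q * (1 + Fintype.card (State N)) ^ (s.time : ℕ) := by
  classical
  have hQ := N.Q_pos
  induction hk : (s.time : ℕ) generalizing s with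
  | zero =>
    by_cases ht : (s.time : ℕ) < T
    · rw [hx.stateFlow_eq ht, inflow_eq_zero hk]
      split_ifs <;> simp [hQ.le]
    · rw [stateFlow_eq_zero_of_le (not_lt.1 ht)]; simp [hQ.le]
  | succ k ih =>
    by_cases ht : (s.time : ℕ) < T
    · have hne : s ≠ initialState N := by
        rintro rfl; simp [initialState] at hk
      rw [hx.stateFlow_eq ht, if_neg hne, add_zero]
      have hb : ∀ r : State N, ∑ a : Act r, x r a * transProb r a s ≤
          N.Q * (1 + Fintype.card (State N)) ^ k := by
        intro r
        by_cases hr : (r.time : ℕ) = k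
        · refine le_trans (Finset.sum_le_sum fun a _ => ?_) (ih r hr)
          exact mul_le_of_le_one_right (hx.1 r a) (transProb_le_one r a s)
        · rw [Finset.sum_eq_zero fun a _ => ?_]
          · positivity
          · by_cases h0 : transProb r a s = 0
            · simp [h0]
            · have := time_eq_of_transProb_ne_zero h0; omega
      refine (Finset.sum_le_sum fun r _ => hb r).trans ?_
      simp only [Finset.sum_const, Finset.card_univ, nsmul_eq_mul, pow_succ]
      have : 0 ≤ N.Q * (1 + (Fintype.card (State N) : ℝ)) ^ k := by positivity
      nlinarith
    · rw [stateFlow_eq_zero_of_le (not_lt.1 ht)]; positivity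

theorem continuous_stateFlow (s : State N) :
    Continuous fun x : StateAction N => stateFlow x s := by
  unfold stateFlow; fun_prop

theorem isCompact_feasibleFlow : IsCompact {x : StateAction N | IsFeasibleFlow x} := by
  classical
  have hcl : IsClosed {x : StateAction N | IsFeasibleFlow x} := by
    simp only [IsFeasibleFlow, Set.ofPred_and, Set.ofPred_forall]
    refine IsClosed.inter ?_ ?_
    · exact isClosed_iInter fun s => isClosed_iInter fun a =>
        isClosed_le continuous_const (by fun_prop)
    · refine isClosed_iInter fun s => isClosed_iInter fun _ => isClosed_eq ?_ continuous_const
      exact (continuous_stateFlow s).sub (by fun_prop)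
  have hK : IsCompact (Set.pi Set.univ fun s : State N => Set.pi Set.univ fun _ : Act s =>
      Set.Icc (0 : ℝ) (N.Q * (1 + Fintype.card (State N)) ^ (s.time : ℕ))) :=
    isCompact_univ_pi fun s => isCompact_univ_pi fun a => isCompact_Icc
  refine hK.of_isClosed_subset hcl fun x hx s _ a _ => ⟨hx.1 s a, ?_⟩
  exact (le_stateFlow hx s a).trans (hx.stateFlow_le s)

/-! ### Policies and flows -/

theorem exists_isPolicy : ∃ π : StateAction N, IsPolicy π := by
  refine ⟨fun s _ => 1 / Fintype.card (Act s), fun s hs => ?_⟩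
  have := exists_feasible hs
  have hc : 0 < (Fintype.card (Act s) : ℝ) := by exact_mod_cast Fintype.card_pos
  exact ⟨fun a => by positivity, by simp [hc.ne']⟩

theorem IsPolicy.pos {π : StateAction N} (hπ : IsPolicy π) (s : State N) (a : Act s) :
    0 < π s a := (hπ s a.2.time_lt).1 a

theorem visitProb_nonneg {π : StateAction N} (hπ : IsPolicy π) (k : ℕ) (s : State N) :
    0 ≤ visitProb π k s := by
  induction k generalizing s with
  | zero => unfold visitProb; split_ifs <;> norm_num
  | succ k ih =>
    unfold visitProb
    exact Finset.sum_nonneg fun r _ => Finset.sum_nonneg fun a _ =>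
      mul_nonneg (mul_nonneg (ih r) (hπ.pos r a).le) (transProb_nonneg r a s)

theorem visitProb_eq_zero {π : StateAction N} {k : ℕ} {s : State N} (h : (s.time : ℕ) ≠ k) :
    visitProb π k s = 0 := by
  induction k generalizing s with
  | zero =>
    unfold visitProb
    rw [if_neg]; rintro rfl; simp [initialState] at h
  | succ k ih =>
    unfold visitProb
    refine Finset.sum_eq_zero fun r _ => Finset.sum_eq_zero fun a _ => ?_
    by_cases hr : transProb r a s = 0
    · simp [hr]
    · have := time_eq_of_transProb_ne_zero hr
      rw [ih (by omega)]; simp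

theorem stateFlow_policyFlow {π : StateAction N} (hπ : IsPolicy π) {s : State N}
    (hs : (s.time : ℕ) < T) : stateFlow (policyFlow π) s = N.Q * visitProb π s.time s := by
  unfold stateFlow policyFlow
  rw [← Finset.mul_sum, (hπ s hs).2, mul_one]

theorem inflow_policyFlow {π : StateAction N} {k : ℕ} {s : State N} (hk : (s.time : ℕ) = k + 1) :
    inflow (policyFlow π) s = N.Q * visitProb π (k + 1) s := by
  rw [visitProb, Finset.mul_sum]
  refine Finset.sum_congr rfl fun r _ => ?_
  rw [Finset.mul_sum]
  refine Finset.sum_congr rfl fun a _ => ?_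
  by_cases hr : transProb r a s = 0
  · simp [hr]
  · have := time_eq_of_transProb_ne_zero hr
    have : (r.time : ℕ) = k := by omega
    simp only [policyFlow, this]; ring

theorem policyFlow_nonneg {π : StateAction N} (hπ : IsPolicy π) (s : State N) (a : Act s) :
    0 ≤ policyFlow π s a :=
  mul_nonneg (mul_nonneg N.Q_pos.le (visitProb_nonneg hπ _ _)) (hπ.pos s a).le

theorem inFlowDomain_policyFlow {π : StateAction N} (hπ : IsPolicy π) :
    InFlowDomain (policyFlow π) := by
  classical
  refine ⟨⟨policyFlow_nonneg hπ, fun s hs => ?_⟩, fun s hs a => ?_⟩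
  · rw [stateFlow_policyFlow hπ hs]
    change _ - inflow (policyFlow π) s = _
    rcases hk : (s.time : ℕ) with _ | k
    · rw [inflow_eq_zero hk, visitProb]
      split_ifs <;> simp
    · rw [inflow_policyFlow hk, if_neg, sub_self]
      rintro rfl; simp [initialState] at hk
  · have ht := time_lt_of_stateFlow_pos hs
    rw [stateFlow_policyFlow hπ ht] at hs
    exact mul_pos hs (hπ.pos s a)

/-- Every flow in the domain of the perturbation is the flow of a policy. -/
theorem InFlowDomain.exists_policy {x : StateAction N} (hx : InFlowDomain x) :
    ∃ π, IsPolicy π ∧ x = policyFlow π := by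
  classical
  obtain ⟨π₀, hπ₀⟩ := exists_isPolicy (N := N)
  -- Where `x` carries no flow its composition is undefined; an arbitrary policy `π₀` fills in
  -- without affecting the flow.
  let π : StateAction N := fun s => if 0 < stateFlow x s then normalize (x s) else π₀ s
  have hπ : IsPolicy π := fun s hs => by
    simp only [π]
    split_ifs with h
    · exact normalize_mem_openSimplex (hx.2 s h) h
    · exact hπ₀ s hs
  have hmul : ∀ s a, x s a = stateFlow x s * π s a := fun s a => by
    simp only [π]
    split_ifs with h
    · have : (∑ b, x s b) ≠ 0 := h.ne'
      simp only [normalize, stateFlow]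
      field_simp
    · have h0 : stateFlow x s = 0 := le_antisymm (not_lt.1 h) (hx.1.stateFlow_nonneg s)
      rw [hx.1.eq_zero_of_stateFlow_eq_zero h0, h0]; simp
  have key : ∀ k, ∀ s : State N, (s.time : ℕ) = k → k < T →
      stateFlow x s = N.Q * visitProb π k s := by
    intro k
    induction k with
    | zero =>
      intro s hs hT
      rw [hx.1.stateFlow_eq (by omega), inflow_eq_zero hs, visitProb]
      split_ifs <;> simp
    | succ k ih =>
      intro s hs hT
      rw [hx.1.stateFlow_eq (by omega), if_neg, add_zero, visitProb, Finset.mul_sum]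
      · refine Finset.sum_congr rfl fun r _ => ?_
        rw [Finset.mul_sum]
        refine Finset.sum_congr rfl fun a _ => ?_
        by_cases hr : transProb r a s = 0
        · simp [hr]
        · have := time_eq_of_transProb_ne_zero hr
          rw [hmul r a, ih r (by omega) (by omega)]; ring
      · rintro rfl; simp [initialState] at hs
  refine ⟨π, hπ, ?_⟩
  funext s a
  rw [hmul s a, key s.time s rfl a.2.time_lt]; rfl

theorem flowPerturbation_eq_sum (F : (s : State N) → (Act s → ℝ) → ℝ) (x : StateAction N) :
    flowPerturbation F x = ∑ s, perspective (F s) (x s) := rfl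

/-- A state records its time, so only one term of the sum over time survives. Homogeneity then
absorbs the visiting probability into the perturbation term, and the decision process becomes a
concave program over flows. -/
theorem mul_value_eq (F : (s : State N) → (Act s → ℝ) → ℝ) (u : StateAction N)
    {π : StateAction N} (hπ : IsPolicy π) :
    N.Q * value F u π =
      ∑ s, ∑ a, policyFlow π s a * u s a - flowPerturbation F (policyFlow π) := by
  unfold value
  rw [Finset.sum_comm, flowPerturbation_eq_sum, ← Finset.sum_sub_distrib, Finset.mul_sum]
  refine Finset.sum_congr rfl fun s _ => ?_
  have hQ := N.Q_pos
  by_cases hs : (s.time : ℕ) < T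
  · rw [Finset.sum_eq_single_of_mem (s.time : ℕ) (Finset.mem_range.2 hs)
      fun k _ hk => by rw [visitProb_eq_zero hk.symm, zero_mul]]
    have h1 : perspective (F s) (policyFlow π s) = N.Q * visitProb π s.time s * F s (π s) := by
      have hsum : ∑ a, policyFlow π s a = N.Q * visitProb π s.time s :=
        stateFlow_policyFlow hπ hs
      unfold perspective
      rcases (visitProb_nonneg hπ s.time s).eq_or_lt with h0 | h0
      · rw [hsum, ← h0]; simp
      · have : normalize (policyFlow π s) = π s := by
          funext a
          simp only [normalize, hsum]
          simp only [policyFlow]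
          field_simp
        rw [this, hsum]
    rw [h1]
    simp only [policyFlow]
    rw [mul_sub, mul_sub, Finset.mul_sum, Finset.mul_sum]
    congr 1
    · exact Finset.sum_congr rfl fun a _ => by ring
    · ring
  · have : IsEmpty (Act s) := ⟨fun a => hs a.2.time_lt⟩
    rw [Finset.sum_eq_zero fun k hk => ?_]
    · simp [perspective]
    · rw [visitProb_eq_zero (by have := Finset.mem_range.1 hk; omega), zero_mul]

/-! ### The perturbation term on its domain -/

theorem stateFlow_combination (x y : StateAction N) (t : ℝ) (s : State N) :
    stateFlow ((1 - t) • x + t • y) s = (1 - t) * stateFlow x s + t * stateFlow y s :=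
  sum_combination (x s) (y s) t

theorem InFlowDomain.pos {x : StateAction N} (hx : InFlowDomain x) {s : State N}
    (hs : 0 < stateFlow x s) (a : Act s) : 0 < x s a := hx.2 s hs a

theorem InFlowDomain.combination {x y : StateAction N} (hx : InFlowDomain x) (hy : InFlowDomain y)
    {t : ℝ} (h0 : 0 ≤ t) (h1 : t ≤ 1) : InFlowDomain ((1 - t) • x + t • y) := by
  classical
  refine ⟨⟨fun s a => ?_, fun s hs => ?_⟩, fun s hs a => ?_⟩
  · have := mul_nonneg (sub_nonneg.2 h1) (hx.1.1 s a)
    have := mul_nonneg h0 (hy.1.1 s a)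
    simp only [Pi.add_apply, Pi.smul_apply, smul_eq_mul]
    linarith
  · have h2 := hx.1.2 s hs
    have h3 := hy.1.2 s hs
    rw [stateFlow_combination]
    simp only [Pi.add_apply, Pi.smul_apply, smul_eq_mul, add_mul, Finset.sum_add_distrib,
      mul_assoc, ← Finset.mul_sum]
    rw [show ∀ A B C D : ℝ, (1 - t) * A + t * B - ((1 - t) * C + t * D) =
      (1 - t) * (A - C) + t * (B - D) by intros; ring, h2, h3]
    ring
  · have hxs : 0 < stateFlow x s := by
      by_contra h
      have h2 : stateFlow x s = 0 := le_antisymm (not_lt.1 h) (hx.1.stateFlow_nonneg s)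
      have h3 : stateFlow y s = 0 := by
        refine le_antisymm (not_lt.1 fun h3 => h (hy.stateFlow_pos hx h3))
          (hy.1.stateFlow_nonneg s)
      rw [stateFlow_combination, h2, h3] at hs
      simp at hs
    have hys := hx.stateFlow_pos hy hxs
    have h2 := hx.pos hxs a
    have h3 := hy.pos hys a
    simp only [Pi.add_apply, Pi.smul_apply, smul_eq_mul]
    rcases h0.eq_or_lt with rfl | h0
    · simpa using h2
    · have := mul_nonneg (sub_nonneg.2 h1) h2.le
      have := mul_pos h0 h3
      linarith

variable {F : (s : State N) → (Act s → ℝ) → ℝ}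

theorem InFlowDomain.stateFlow_eq_zero {x y : StateAction N} (hx : InFlowDomain x)
    (hy : InFlowDomain y) {s : State N} (h : ¬ 0 < stateFlow x s) :
    stateFlow y s = 0 :=
  le_antisymm (not_lt.1 fun h3 => h (hy.stateFlow_pos hx h3)) (hy.1.stateFlow_nonneg s)

theorem perspective_eq_zero {x : StateAction N} {s : State N} (h : stateFlow x s = 0) :
    perspective (F s) (x s) = 0 := by
  have : ∑ a, x s a = 0 := h
  simp [perspective, this]

theorem perspective_state_combination_le (hF : ∀ s, IsPerturbation (F s)) {x y : StateAction N}
    (hx : InFlowDomain x) (hy : InFlowDomain y) {t : ℝ} (h0 : 0 ≤ t) (h1 : t ≤ 1) (s : State N) :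
    perspective (F s) (((1 - t) • x + t • y) s) ≤
      (1 - t) * perspective (F s) (x s) + t * perspective (F s) (y s) := by
  by_cases h : 0 < stateFlow x s
  · have h' := hx.stateFlow_pos hy h
    exact (hF s).perspective_combination_le h h' (hx.pos h) (hy.pos h') h0 h1
  · rw [perspective_eq_zero (hx.stateFlow_eq_zero (hx.combination hy h0 h1) h),
      perspective_eq_zero (hx.stateFlow_eq_zero hx h),
      perspective_eq_zero (hx.stateFlow_eq_zero hy h)]
    simp

theorem flowPerturbation_combination_le (hF : ∀ s, IsPerturbation (F s)) {x y : StateAction N}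
    (hx : InFlowDomain x) (hy : InFlowDomain y) {t : ℝ} (h0 : 0 ≤ t) (h1 : t ≤ 1) :
    flowPerturbation F ((1 - t) • x + t • y) ≤
      (1 - t) * flowPerturbation F x + t * flowPerturbation F y := by
  simp only [flowPerturbation_eq_sum, Finset.mul_sum]
  rw [← Finset.sum_add_distrib]
  exact Finset.sum_le_sum fun s _ => perspective_state_combination_le hF hx hy h0 h1 s

/-- Conservation determines the total flow through a state from the flows one time step earlier, and
the composition then distributes it over the actions. Hence the compositions determine the flow by
induction on time. -/
theorem eq_of_normalize_eq {x y : StateAction N} (hx : InFlowDomain x) (hy : InFlowDomain y)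
    (h : ∀ s, 0 < stateFlow x s → normalize (x s) = normalize (y s)) : x = y := by
  classical
  have hmul : ∀ s, stateFlow x s = stateFlow y s → x s = y s := fun s hs => by
    by_cases hp : 0 < stateFlow x s
    · have h1 := h s hp
      funext a
      have h2 := congrFun h1 a
      have h3 : (∑ b, y s b) = ∑ b, x s b := hs.symm
      have h4 : (∑ b, x s b) ≠ 0 := hp.ne'
      simp only [normalize, h3] at h2
      field_simp at h2
      exact h2
    · rw [hx.1.eq_zero_of_stateFlow_eq_zero (hx.stateFlow_eq_zero hx hp),
        hy.1.eq_zero_of_stateFlow_eq_zero (hx.stateFlow_eq_zero hy hp)]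
  have key : ∀ k, ∀ s : State N, (s.time : ℕ) = k → stateFlow x s = stateFlow y s := by
    intro k
    induction k with
    | zero =>
      intro s hs
      by_cases hT : (s.time : ℕ) < T
      · rw [hx.1.stateFlow_eq hT, hy.1.stateFlow_eq hT, inflow_eq_zero hs, inflow_eq_zero hs]
      · rw [stateFlow_eq_zero_of_le (not_lt.1 hT), stateFlow_eq_zero_of_le (not_lt.1 hT)]
    | succ k ih =>
      intro s hs
      by_cases hT : (s.time : ℕ) < T
      · rw [hx.1.stateFlow_eq hT, hy.1.stateFlow_eq hT]
        congr 1
        refine Finset.sum_congr rfl fun r _ => Finset.sum_congr rfl fun a _ => ?_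
        by_cases hr : transProb r a s = 0
        · simp [hr]
        · have := time_eq_of_transProb_ne_zero hr
          rw [hmul r (ih r (by omega))]
      · rw [stateFlow_eq_zero_of_le (not_lt.1 hT), stateFlow_eq_zero_of_le (not_lt.1 hT)]
  funext s
  exact hmul s (key s.time s rfl)

theorem flowPerturbation_combination_lt (hF : ∀ s, IsPerturbation (F s)) {x y : StateAction N}
    (hx : InFlowDomain x) (hy : InFlowDomain y) (hne : x ≠ y) {t : ℝ} (h0 : 0 < t) (h1 : t < 1) :
    flowPerturbation F ((1 - t) • x + t • y) <
      (1 - t) * flowPerturbation F x + t * flowPerturbation F y := by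
  have : ∃ s, 0 < stateFlow x s ∧ normalize (x s) ≠ normalize (y s) := by
    by_contra! h
    exact hne (eq_of_normalize_eq hx hy h)
  obtain ⟨s, hs, hs'⟩ := this
  simp only [flowPerturbation_eq_sum, Finset.mul_sum]
  rw [← Finset.sum_add_distrib]
  refine Finset.sum_lt_sum
    (fun s _ => perspective_state_combination_le hF hx hy h0.le h1.le s)
    ⟨s, Finset.mem_univ _, ?_⟩
  have h' := hx.stateFlow_pos hy hs
  exact (hF s).perspective_combination_lt hs h' (hx.pos hs) (hy.pos h') h0 h1 hs'

/-- All flows in the domain share one support, so each summand is either evaluated at strictly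
positive flows or identically zero. -/
theorem continuousOn_flowPerturbation (hF : ∀ s, IsPerturbation (F s)) :
    ContinuousOn (flowPerturbation F) {x | InFlowDomain x} := by
  intro x hx
  simp only [funext (flowPerturbation_eq_sum F)]
  refine tendsto_finsetSum _ fun s _ => ?_
  by_cases hs : 0 < stateFlow x s
  · have h1 : ContinuousAt (perspective (F s)) (x s) :=
      (hF s).continuousAt_perspective (InFlowDomain.pos hx hs) hs
    have h2 : Continuous fun x : StateAction N => x s := continuous_apply s
    exact (h1.comp (f := fun x : StateAction N => x s) h2.continuousAt).continuousWithinAt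
  · have : ∀ y ∈ {x : StateAction N | InFlowDomain x}, perspective (F s) (y s) = 0 := fun y hy =>
      perspective_eq_zero (InFlowDomain.stateFlow_eq_zero hx hy hs)
    rw [this x hx]
    exact tendsto_const_nhds.congr' (by
      filter_upwards [self_mem_nhdsWithin] with y hy using (this y hy).symm)

theorem exists_flowPerturbation_lower_bound (hF : ∀ s, IsPerturbation (F s)) :
    ∃ m, ∀ x : StateAction N, InFlowDomain x → m ≤ flowPerturbation F x := by
  choose m hm using fun s => (hF s).exists_lower_bound
  have hc : Continuous fun x : StateAction N => ∑ s, stateFlow x s * m s := by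
    have := fun s : State N => continuous_stateFlow s
    fun_prop
  obtain ⟨B, hB⟩ := (isCompact_feasibleFlow (N := N)).bddBelow_image hc.continuousOn
  refine ⟨B, fun x hx => (hB ⟨x, hx.1, rfl⟩).trans ?_⟩
  refine Finset.sum_le_sum fun s _ => ?_
  by_cases hs : 0 < stateFlow x s
  · exact mul_le_mul_of_nonneg_left (hm s _ (normalize_mem_openSimplex (hx.pos hs) hs)) hs.le
  · rw [hx.stateFlow_eq_zero hx hs]; simp

end

/-! ### The operator's problem -/

section

variable {T : ℕ} {Zone Load : Type*} {N : Logistics T Zone Load} [Fintype Zone]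
  {F : (s : State N) → (Act s → ℝ) → ℝ}

/-- A maximizing sequence of a concave function minus the perturbation accumulates at a maximizer
in the domain of the perturbation. -/
theorem exists_maximizer_of_tendsto (hF : ∀ s, IsPerturbation (F s)) {G : StateAction N → ℝ}
    (hG : ContinuousOn G {x | IsFeasibleFlow x})
    (hGc : ∀ x y, InFlowDomain x → InFlowDomain y → ∀ t : ℝ, 0 ≤ t → t ≤ 1 →
      (1 - t) * G x + t * G y ≤ G ((1 - t) • x + t • y))
    {x : ℕ → StateAction N} (hx : ∀ n, InFlowDomain (x n)) {S : ℝ}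
    (hS : ∀ y, InFlowDomain y → G y - flowPerturbation F y ≤ S)
    (hlim : Tendsto (fun n => G (x n) - flowPerturbation F (x n)) atTop (𝓝 S)) :
    ∃ (x' : StateAction N) (φ : ℕ → ℕ), InFlowDomain x' ∧ StrictMono φ ∧ Tendsto (x ∘ φ) atTop (𝓝 x') ∧
      G x' - flowPerturbation F x' = S := by
  classical
  obtain ⟨x', hx'f, φ, hφ, hconv⟩ :=
    isCompact_feasibleFlow.tendsto_subseq (fun n => (hx n).1)
  replace hx'f : IsFeasibleFlow x' := hx'f
  have hlim' := hlim.comp hφ.tendsto_atTop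
  by_cases hdom : InFlowDomain x'
  · refine ⟨x', φ, hdom, hφ, hconv, ?_⟩
    have h1 : Tendsto (x ∘ φ) atTop (𝓝[{x | InFlowDomain x}] x') :=
      tendsto_nhdsWithin_iff.2 ⟨hconv, Eventually.of_forall fun n => hx _⟩
    have h2 := ((hG.mono fun y hy => hy.1).sub (continuousOn_flowPerturbation hF)) x' hdom
    exact tendsto_nhds_unique (h2.tendsto.comp h1) hlim'
  exfalso
  -- If the limit leaves the domain, some visited state has an action without flow. There, shifting
  -- towards the interior flow `w` gains at an arbitrarily high rate.
  have : ∃ s, 0 < stateFlow x' s ∧ ∃ a, x' s a = 0 := by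
    by_contra! h
    exact hdom ⟨hx'f, fun s hs a => lt_of_le_of_ne (hx'f.1 s a) (h s hs a).symm⟩
  obtain ⟨s, hs, ha⟩ := this
  set w := x 0
  have hw : InFlowDomain w := hx 0
  have hws : 0 < stateFlow w s := by
    have := ((continuous_stateFlow s).tendsto x').comp hconv
    obtain ⟨n, hn⟩ := (this.eventually_const_lt hs).exists
    exact (hx (φ n)).stateFlow_pos hw hn
  -- This rate cancels the contributions of `w` and leaves `S + 1`: mixing in weight `t` of `w` is
  -- at least as good as mixing in weight `t` of the unattainable value `S + 1`.
  set C := (S + 1 - G w + flowPerturbation F w - perspective (F s) (w s)) / stateFlow w s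
  have hC : stateFlow w s * C =
      S + 1 - G w + flowPerturbation F w - perspective (F s) (w s) := by
    simp only [C]; field_simp
  have hev := (hF s).eventually_perspective_le (hx'f.1 s) hs ha (hw.pos hws) hws C
  have hpath : Tendsto (fun t : ℝ => (1 - t) • x' s + t • w s) (𝓝[>] 0) (𝓝 (x' s)) := by
    have : Continuous fun t : ℝ => (1 - t) • x' s + t • w s := by fun_prop
    have h := this.tendsto 0
    simp only [sub_zero, one_smul, zero_smul, add_zero] at h
    exact h.mono_left nhdsWithin_le_nhds
  -- The weight `t` is fixed before `n`. Since the estimate holds on a whole neighborhood of the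
  -- mixed limit point, it also holds at the mixtures of late members of the sequence.
  obtain ⟨t, ht, ht0, ht1⟩ := ((hpath.eventually (eventually_eventually_nhds.2 hev)).and
    (Ioo_mem_nhdsGT (zero_lt_one' ℝ))).exists
  have hseq : Tendsto (fun n => (1 - t) • (x ∘ φ) n s + t • w s) atTop
      (𝓝 ((1 - t) • x' s + t • w s)) :=
    ((((continuous_apply s).tendsto x').comp hconv).const_smul _).add_const _
  have hbound : ∀ᶠ n in atTop, (1 - t) * (G (x (φ n)) - flowPerturbation F (x (φ n))) +
      t * (S + 1) ≤ S := by
    filter_upwards [hseq.eventually ht] with n hn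
    have hxs : 0 < stateFlow (x (φ n)) s := hw.stateFlow_pos (hx _) hws
    have h1 := hn (x (φ n) s) ((hx _).pos hxs) t ht0.le ht1.le rfl
    have h2 := hGc _ _ (hx (φ n)) hw t ht0.le ht1.le
    have h3 := hS _ ((hx (φ n)).combination hw ht0.le ht1.le)
    have h4 : flowPerturbation F ((1 - t) • x (φ n) + t • w) ≤
        (1 - t) * flowPerturbation F (x (φ n)) + t * flowPerturbation F w -
          t * (perspective (F s) (w s) + stateFlow w s * C) := by
      have h5 : ∀ r ∈ Finset.univ.erase s, perspective (F r) (((1 - t) • x (φ n) + t • w) r) ≤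
          (1 - t) * perspective (F r) (x (φ n) r) + t * perspective (F r) (w r) := fun r _ =>
        perspective_state_combination_le hF (hx _) hw ht0.le ht1.le r
      have h6 := Finset.sum_le_sum h5
      rw [Finset.sum_add_distrib, ← Finset.mul_sum, ← Finset.mul_sum] at h6
      simp only [flowPerturbation_eq_sum]
      rw [← Finset.add_sum_erase _ _ (Finset.mem_univ s),
        ← Finset.add_sum_erase _ (fun r => perspective (F r) (x (φ n) r)) (Finset.mem_univ s),
        ← Finset.add_sum_erase _ (fun r => perspective (F r) (w r)) (Finset.mem_univ s)]
      have h7 : perspective (F s) (((1 - t) • x (φ n) + t • w) s) ≤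
        (1 - t) * perspective (F s) (x (φ n) s) - t * stateFlow w s * C := h1
      linarith
    rw [hC] at h4
    linarith
  -- In the limit `(1 - t) * S + t * (S + 1) ≤ S`, which contradicts `t > 0`.
  have hl2 := (hlim'.const_mul (1 - t)).add_const (t * (S + 1))
  have := le_of_tendsto hl2 hbound
  linarith

/-! ### The smooth part of the profit -/

variable (N) in
/-- The served demand as a linear map. -/
noncomputable def servedDemandₗ : StateAction N →ₗ[ℝ] DemandIndex N → ℝ where
  toFun := servedDemand
  map_add' x y := Matrix.mulVec_add _ (deliveryFlow x) (deliveryFlow y)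
  map_smul' c x := Matrix.mulVec_smul _ c (deliveryFlow x)

variable (N) in
/-- The charging load (in charging actions per time and bus) as a linear map. -/
noncomputable def chargingLoadₗ : StateAction N →ₗ[ℝ] Fin T × Load → ℝ where
  toFun x := (chargeIncidence N).mulVec (chargingFlow x)
  map_add' x y := Matrix.mulVec_add _ (chargingFlow x) (chargingFlow y)
  map_smul' c x := Matrix.mulVec_smul _ c (chargingFlow x)

variable (N) in
/-- The teleporting flow as a linear map. -/
noncomputable def teleportFlowₗ : StateAction N →ₗ[ℝ] ℝ where
  toFun := teleportFlow
  map_add' x y := by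
    simp only [teleportFlow, ← Finset.sum_add_distrib]
    refine Finset.sum_congr rfl fun s _ => Finset.sum_congr rfl fun a _ => ?_
    split_ifs <;> simp
  map_smul' c x := by
    simp only [teleportFlow, Finset.mul_sum, RingHom.id_apply, smul_eq_mul]
    refine Finset.sum_congr rfl fun s _ => Finset.sum_congr rfl fun a _ => ?_
    split_ifs <;> simp

theorem servedDemand_nonneg {x : StateAction N} (hx : IsFeasibleFlow x) : 0 ≤ servedDemand x := by
  intro i
  refine Finset.sum_nonneg fun c _ => mul_nonneg ?_ (hx.1 _ _)
  simp only [deliveryIncidence, Matrix.of_apply]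
  split_ifs <;> norm_num

open Classical in
theorem sum_reward_mul (μD : DeliveryAction N → ℝ) (μC : ChargingAction N → ℝ)
    (y : StateAction N) :
    ∑ s, ∑ a, y s a * reward μD μC s a =
      μD ⬝ᵥ deliveryFlow y + μC ⬝ᵥ chargingFlow y - N.ρ * teleportFlow y := by
  -- Delivery, charging and teleporting actions are mutually exclusive, so the nested cases of
  -- `reward` become a sum.
  have hsplit : ∀ s (a : Act s), y s a * reward μD μC s a =
      (if h : a.1 = Action.deliver then μD ⟨⟨s, a⟩, h⟩ * y s a else 0) +
      (if h : IsCharging s a.1 then μC ⟨⟨s, a⟩, h⟩ * y s a else 0) -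
      N.ρ * (if a.1 = Action.teleport then y s a else 0) := by
    intro s a
    unfold reward
    by_cases h1 : a.1 = Action.deliver
    · have h2 : ¬ IsCharging s a.1 := by
        rintro (⟨_, _, h⟩ | ⟨-, h⟩) <;> rw [h1] at h <;> cases h
      have h3 : a.1 ≠ Action.teleport := by rw [h1]; rintro ⟨⟩
      simp only [dif_pos h1, dif_neg h2, if_neg h3]; ring
    · by_cases h2 : IsCharging s a.1
      · have h3 : a.1 ≠ Action.teleport := by
          intro h3
          rcases h2 with ⟨_, _, h⟩ | ⟨-, h⟩ <;> rw [h3] at h <;> cases h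
        simp only [dif_pos h2, dif_neg h1, if_neg h3]; ring
      · simp only [dif_neg h1, dif_neg h2]
        split_ifs <;> ring
  simp only [hsplit, Finset.sum_sub_distrib, Finset.sum_add_distrib, teleportFlow, Finset.mul_sum]
  congr 2
  · rw [Finset.sum_sigma', Finset.univ_sigma_univ]
    refine (Fintype.sum_of_injective Subtype.val Subtype.val_injective _ _ ?_ ?_).symm
    · intro c hc
      rw [dif_neg]
      intro h; exact hc ⟨⟨c, h⟩, rfl⟩
    · rintro ⟨c, h⟩
      simp [deliveryFlow, h]
  · rw [Finset.sum_sigma', Finset.univ_sigma_univ]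
    refine (Fintype.sum_of_injective Subtype.val Subtype.val_injective _ _ ?_ ?_).symm
    · intro c hc
      rw [dif_neg]
      intro h; exact hc ⟨⟨c, h⟩, rfl⟩
    · rintro ⟨c, h⟩
      simp [chargingFlow, h]

variable {D : PartialEquiv (DemandIndex N → ℝ) (DemandIndex N → ℝ)}

theorem continuousOn_revenue (hD : ∀ z, 0 ≤ z → DifferentiableAt ℝ D.symm z) :
    ContinuousOn (fun x : StateAction N => D.symm (servedDemand x) ⬝ᵥ servedDemand x)
      {x | IsFeasibleFlow x} := by
  have h1 : Continuous fun x : StateAction N => servedDemand x :=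
    (servedDemandₗ N).continuous_of_finiteDimensional
  have h2 : ContinuousOn (fun x : StateAction N => D.symm (servedDemand x))
      {x | IsFeasibleFlow x} := fun x hx =>
    (((hD _ (servedDemand_nonneg hx)).continuousAt).comp h1.continuousAt).continuousWithinAt
  refine continuousOn_finsetSum _ fun i _ => ContinuousOn.mul ?_ ?_
  · exact (continuous_apply i).comp_continuousOn h2
  · exact ((continuous_apply i).comp h1).continuousOn

variable [Fintype Load]

/-- The profit without the perturbation. -/
noncomputable def grossProfit (D : PartialEquiv (DemandIndex N → ℝ) (DemandIndex N → ℝ))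
    (p : Fin T × Load → ℝ) (x : StateAction N) : ℝ :=
  D.symm (servedDemand x) ⬝ᵥ servedDemand x - p ⬝ᵥ chargingLoadₗ N x - N.ρ * teleportFlowₗ N x

theorem profit_eq (p : Fin T × Load → ℝ) (x : StateAction N) :
    profit F D p x = grossProfit D p x - flowPerturbation F x := rfl

theorem profit_sub_profit (p q : Fin T × Load → ℝ) (x : StateAction N) :
    profit F D p x - profit F D q x = (q - p) ⬝ᵥ chargingLoadₗ N x := by
  simp only [profit_eq, grossProfit, sub_dotProduct]; ring

theorem continuousOn_grossProfit (hD : ∀ z, 0 ≤ z → DifferentiableAt ℝ D.symm z)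
    (p : Fin T × Load → ℝ) : ContinuousOn (grossProfit D p) {x | IsFeasibleFlow x} := by
  have h1 := (chargingLoadₗ N).continuous_of_finiteDimensional
  have h2 := (teleportFlowₗ N).continuous_of_finiteDimensional
  refine ((continuousOn_revenue hD).sub (Continuous.continuousOn ?_)).sub
    (Continuous.continuousOn (by fun_prop))
  exact continuous_const.dotProduct h1

theorem grossProfit_combination_ge
    (hDc : ConcaveOn ℝ {z : DemandIndex N → ℝ | 0 ≤ z} fun z => D.symm z ⬝ᵥ z)
    (p : Fin T × Load → ℝ) {x y : StateAction N} (hx : IsFeasibleFlow x) (hy : IsFeasibleFlow y)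
    {t : ℝ} (h0 : 0 ≤ t) (h1 : t ≤ 1) :
    (1 - t) * grossProfit D p x + t * grossProfit D p y ≤
      grossProfit D p ((1 - t) • x + t • y) := by
  have h := hDc.2 (servedDemand_nonneg hx) (servedDemand_nonneg hy) (sub_nonneg.2 h1) h0 (by ring)
  have he : servedDemand ((1 - t) • x + t • y) =
      (1 - t) • servedDemand x + t • servedDemand y := by
    change servedDemandₗ N _ = (1 - t) • servedDemandₗ N x + t • servedDemandₗ N y
    simp
  simp only [grossProfit, he, map_add, map_smul, dotProduct_add, dotProduct_smul, smul_eq_mul]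
    at h ⊢
  linarith

/-! ### Existence, uniqueness and stability of the system optimum -/

theorem exists_isSystemOptimal (hF : ∀ s, IsPerturbation (F s))
    (hD : ∀ z, 0 ≤ z → DifferentiableAt ℝ D.symm z)
    (hDc : ConcaveOn ℝ {z : DemandIndex N → ℝ | 0 ≤ z} fun z => D.symm z ⬝ᵥ z)
    (p : Fin T × Load → ℝ) : ∃ x, IsSystemOptimal F D p x := by
  obtain ⟨π, hπ⟩ := exists_isPolicy (N := N)
  obtain ⟨m, hm⟩ := exists_flowPerturbation_lower_bound hF
  obtain ⟨B, hB⟩ := isCompact_feasibleFlow.bddAbove_image (continuousOn_grossProfit hD p)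
  have hne : (profit F D p '' {x | InFlowDomain x}).Nonempty :=
    ⟨_, _, inFlowDomain_policyFlow hπ, rfl⟩
  have hbdd : BddAbove (profit F D p '' {x | InFlowDomain x}) := by
    refine ⟨B - m, ?_⟩
    rintro _ ⟨x, hx, rfl⟩
    rw [profit_eq]
    exact sub_le_sub (hB ⟨x, hx.1, rfl⟩) (hm x hx)
  obtain ⟨u, -, hu, hmem⟩ := exists_seq_tendsto_sSup hne hbdd
  choose x hx hxu using hmem
  obtain ⟨x', -, hx', -, -, hS⟩ := exists_maximizer_of_tendsto hF (continuousOn_grossProfit hD p)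
    (fun x y hx hy t h0 h1 => grossProfit_combination_ge hDc p hx.1 hy.1 h0 h1) hx
    (S := sSup (profit F D p '' {x | InFlowDomain x}))
    (fun y hy => le_csSup hbdd ⟨y, hy, rfl⟩) (hu.congr fun n => (hxu n).symm)
  refine ⟨x', hx', fun y hy => ?_⟩
  rw [profit_eq p x', hS]
  exact le_csSup hbdd ⟨y, hy, rfl⟩

/-- The midpoint of two distinct optima would have a strictly larger profit. -/
theorem IsSystemOptimal.unique (hF : ∀ s, IsPerturbation (F s))
    (hDc : ConcaveOn ℝ {z : DemandIndex N → ℝ | 0 ≤ z} fun z => D.symm z ⬝ᵥ z)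
    {p : Fin T × Load → ℝ} {x y : StateAction N} (hx : IsSystemOptimal F D p x)
    (hy : IsSystemOptimal F D p y) : x = y := by
  by_contra hne
  have h1 := flowPerturbation_combination_lt hF hx.1 hy.1 hne (t := 1 / 2) (by norm_num)
    (by norm_num)
  have h2 := grossProfit_combination_ge hDc p hx.1.1 hy.1.1 (t := 1 / 2) (by norm_num)
    (by norm_num)
  have h3 := hx.2 _ (hx.1.combination hy.1 (t := 1 / 2) (by norm_num) (by norm_num))
  have h4 := hx.2 y hy.1
  have h5 := hy.2 x hx.1
  simp only [profit_eq] at h3 h4 h5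
  linarith

theorem exists_chargingLoad_bound :
    ∃ B, ∀ x : StateAction N, IsFeasibleFlow x → ‖chargingLoadₗ N x‖ ≤ B := by
  have h1 := (chargingLoadₗ N).continuous_of_finiteDimensional
  obtain ⟨B, hB⟩ := (isCompact_feasibleFlow (N := N)).bddAbove_image h1.norm.continuousOn
  exact ⟨B, fun x hx => hB ⟨x, hx, rfl⟩⟩

/-- System optimal flows depend continuously on the charging prices. -/
theorem exists_tendsto_isSystemOptimal (hF : ∀ s, IsPerturbation (F s))
    (hD : ∀ z, 0 ≤ z → DifferentiableAt ℝ D.symm z)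
    (hDc : ConcaveOn ℝ {z : DemandIndex N → ℝ | 0 ≤ z} fun z => D.symm z ⬝ᵥ z)
    {p : ℕ → Fin T × Load → ℝ} {p' : Fin T × Load → ℝ} (hp : Tendsto p atTop (𝓝 p'))
    {x : ℕ → StateAction N} (hx : ∀ n, IsSystemOptimal F D (p n) (x n)) :
    ∃ (x' : StateAction N) (φ : ℕ → ℕ), IsSystemOptimal F D p' x' ∧ StrictMono φ ∧ Tendsto (x ∘ φ) atTop (𝓝 x') := by
  obtain ⟨y, hy⟩ := exists_isSystemOptimal hF hD hDc p'
  obtain ⟨B, hB⟩ := exists_chargingLoad_bound (N := N)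
  have hdiff : ∀ i, Tendsto (fun n => (p n - p') i) atTop (𝓝 0) := fun i => by
    have := ((continuous_apply i).tendsto p').comp hp
    simpa using this.sub_const (p' i)
  have h1 : Tendsto (fun n => (p n - p') ⬝ᵥ chargingLoadₗ N (x n)) atTop (𝓝 0) := by
    rw [show (0 : ℝ) = ∑ _i : Fin T × Load, 0 by simp]
    refine tendsto_finsetSum _ fun i _ => ?_
    -- The flows `x n` are not yet known to converge; boundedness of their loads is enough.
    refine (hdiff i).zero_mul_isBoundedUnder_le ?_
    refine isBoundedUnder_of ⟨B, fun n => ?_⟩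
    exact (norm_le_pi_norm (chargingLoadₗ N (x n)) i).trans (hB _ (hx n).1.1)
  have h2 : Tendsto (fun n => (p' - p n) ⬝ᵥ chargingLoadₗ N y) atTop (𝓝 0) := by
    rw [show (0 : ℝ) = ∑ i : Fin T × Load, -0 * chargingLoadₗ N y i by simp]
    refine tendsto_finsetSum _ fun i _ => ?_
    refine Tendsto.mul_const _ ((hdiff i).neg.congr fun n => ?_)
    simp
  -- The `x n` form a maximizing sequence at `p'`: comparing `x n` with `y` at the price `p n` costs
  -- only errors linear in `p n - p'`.
  have h3 : Tendsto (fun n => profit F D p' (x n)) atTop (𝓝 (profit F D p' y)) := by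
    refine tendsto_of_tendsto_of_tendsto_of_le_of_le (g := fun n => profit F D p' y +
      (p' - p n) ⬝ᵥ chargingLoadₗ N y + (p n - p') ⬝ᵥ chargingLoadₗ N (x n))
      (h := fun _ => profit F D p' y) ?_ tendsto_const_nhds (fun n => ?_)
      fun n => hy.2 _ (hx n).1
    · simpa using (h2.const_add (profit F D p' y)).add h1
    · have e1 := profit_sub_profit (F := F) (D := D) (p n) p' y
      have e2 := profit_sub_profit (F := F) (D := D) p' (p n) (x n)
      have e3 := (hx n).2 y hy.1
      simp only
      linarith
  obtain ⟨x', φ, hx', hφ, hconv, hS⟩ := exists_maximizer_of_tendsto hF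
    (continuousOn_grossProfit hD p')
    (fun x y hx hy t h0 h1 => grossProfit_combination_ge hDc p' hx.1 hy.1 h0 h1)
    (fun n => (hx n).1) (fun z hz => hy.2 z hz) h3
  refine ⟨x', φ, ⟨hx', fun z hz => ?_⟩, hφ, hconv⟩
  rw [profit_eq p' x', hS]
  exact hy.2 z hz

/-! ### Optimal rewards -/

/-- `gradMatrix` is the transpose of the Jacobian, so moving it across the dot product gives the
directional derivative. -/
theorem gradMatrix_mulVec_dotProduct {ι : Type*} [Fintype ι] (f : (ι → ℝ) → ι → ℝ)
    (z w d : ι → ℝ) : (gradMatrix f z).mulVec w ⬝ᵥ d = fderiv ℝ f z d ⬝ᵥ w := by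
  classical
  have h := LinearMap.pi_apply_eq_sum_univ (fderiv ℝ f z).toLinearMap d
  simp only [ContinuousLinearMap.coe_coe] at h
  rw [h, sum_dotProduct]
  refine Finset.sum_congr rfl fun i _ => ?_
  rw [smul_dotProduct, mul_comm, smul_eq_mul]
  congr 1
  have : (fun j => if i = j then (1 : ℝ) else 0) = Pi.single i 1 := by
    ext j; simp [Pi.single_apply, eq_comm]
  rw [this]
  simp only [Matrix.mulVec, gradMatrix, Matrix.of_apply, dotProduct]

theorem hasDerivAt_revenue_line {ι : Type*} [Fintype ι] {f : (ι → ℝ) → ι → ℝ} {z : ι → ℝ}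
    (hf : DifferentiableAt ℝ f z) (d : ι → ℝ) :
    HasDerivAt (fun t : ℝ => f (z + t • d) ⬝ᵥ (z + t • d))
      (((gradMatrix f z).mulVec z + f z) ⬝ᵥ d) 0 := by
  have h1 : HasDerivAt (fun t : ℝ => z + t • d) d 0 := by
    simpa using ((hasDerivAt_id (0 : ℝ)).smul_const d).const_add z
  have h2 : HasFDerivAt f (fderiv ℝ f z) (z + (0 : ℝ) • d) := by simpa using hf.hasFDerivAt
  have h3 := h2.comp_hasDerivAt (0 : ℝ) h1
  have h4 : HasDerivAt (fun t : ℝ => f (z + t • d) ⬝ᵥ (z + t • d))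
      (∑ i, (fderiv ℝ f z d i * z i + f z i * d i)) 0 := by
    refine HasDerivAt.fun_sum fun i _ => ?_
    have := ((hasDerivAt_pi.1 h3) i).mul ((hasDerivAt_pi.1 h1) i)
    exact this.congr_deriv (by simp)
  convert h4 using 1
  rw [add_dotProduct, gradMatrix_mulVec_dotProduct, Finset.sum_add_distrib]
  rfl

/-- System optimal flows are optimal for the marginal revenues. -/
theorem IsSystemOptimal.linearized (hF : ∀ s, IsPerturbation (F s))
    (hD : ∀ z, 0 ≤ z → DifferentiableAt ℝ D.symm z)
    {p : Fin T × Load → ℝ} {x y : StateAction N} (hx : IsSystemOptimal F D p x)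
    (hy : InFlowDomain y) :
    ((gradMatrix D.symm (servedDemand x)).mulVec (servedDemand x) + D.symm (servedDemand x)) ⬝ᵥ
        (servedDemand y - servedDemand x) ≤
      p ⬝ᵥ (chargingLoadₗ N y - chargingLoadₗ N x) +
        N.ρ * (teleportFlowₗ N y - teleportFlowₗ N x) +
        (flowPerturbation F y - flowPerturbation F x) := by
  set z := servedDemand x
  set d := servedDemand y - z
  have hder := hasDerivAt_revenue_line (hD z (servedDemand_nonneg hx.1.1)) d
  -- Optimality of `x` against points of the segment towards `y` bounds the difference quotients of
  -- the revenue; the other terms are linear, or controlled by convexity of the perturbation term.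
  have hsl := (hasDerivWithinAt_iff_tendsto_slope' (s := Set.Ioi (0 : ℝ))
    (by simp)).1 hder.hasDerivWithinAt
  refine le_of_tendsto hsl ?_
  filter_upwards [Ioc_mem_nhdsGT (zero_lt_one' ℝ)] with t ht
  have h1 := hx.2 _ (hx.1.combination hy ht.1.le ht.2)
  have h2 := flowPerturbation_combination_le hF hx.1 hy ht.1.le ht.2
  have he : servedDemand ((1 - t) • x + t • y) = z + t • d := by
    have : servedDemand ((1 - t) • x + t • y) = (1 - t) • z + t • servedDemand y := by
      change servedDemandₗ N _ = (1 - t) • servedDemandₗ N x + t • servedDemandₗ N y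
      simp
    rw [this]; module
  simp only [profit_eq, grossProfit, he, map_add, map_smul, dotProduct_add, dotProduct_smul,
    smul_eq_mul] at h1
  simp only [slope, sub_zero, zero_smul, add_zero, vsub_eq_sub, smul_eq_mul]
  rw [inv_mul_le_iff₀ ht.1, dotProduct_sub, dotProduct_add, dotProduct_smul, smul_eq_mul]
  change _ - D.symm z ⬝ᵥ z ≤ _
  have h3 : D.symm z ⬝ᵥ z = D.symm (servedDemand x) ⬝ᵥ servedDemand x := rfl
  rw [← h3] at h1
  linarith

/-- Up to the factor `Q`, the value of a policy under the marginal rewards is the linearized profit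
of its flow. As `x` maximizes the latter, any policy generating `x` is optimal. -/
theorem IsSystemOptimal.exists_isOptimalReward (hF : ∀ s, IsPerturbation (F s))
    (hD : ∀ z, 0 ≤ z → DifferentiableAt ℝ D.symm z)
    {p : Fin T × Load → ℝ} {x : StateAction N} (hx : IsSystemOptimal F D p x) :
    ∃ μD μC, IsOptimalReward F D p μD μC x := by
  refine ⟨_, _, ⟨?_, rfl, rfl, hx⟩⟩
  obtain ⟨π, hπ, hxπ⟩ := hx.1.exists_policy
  refine ⟨π, ⟨hπ, fun π' hπ' => ?_⟩, hxπ⟩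
  have hy := inFlowDomain_policyFlow hπ'
  refine le_of_mul_le_mul_left ?_ N.Q_pos
  rw [mul_value_eq F _ hπ, mul_value_eq F _ hπ', ← hxπ]
  set y := policyFlow π'
  have hlin := hx.linearized hF hD hy
  rw [sum_reward_mul, sum_reward_mul]
  have hdel : ∀ (v : DemandIndex N → ℝ) (y : StateAction N),
      (deliveryIncidence N).transpose.mulVec v ⬝ᵥ deliveryFlow y = v ⬝ᵥ servedDemand y := by
    intro v y
    rw [servedDemand, Matrix.dotProduct_mulVec, Matrix.mulVec_transpose]
  have hch : ∀ (v : Fin T × Load → ℝ) (y : StateAction N),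
      -(chargeIncidence N).transpose.mulVec v ⬝ᵥ chargingFlow y = -(v ⬝ᵥ chargingLoadₗ N y) := by
    intro v y
    change _ = -(v ⬝ᵥ (chargeIncidence N).mulVec (chargingFlow y))
    rw [Matrix.dotProduct_mulVec, neg_dotProduct, Matrix.mulVec_transpose]
  rw [hdel, hdel, hch, hch]
  rw [dotProduct_sub, dotProduct_sub] at hlin
  change _ - N.ρ * teleportFlowₗ N y - _ ≤ _ - N.ρ * teleportFlowₗ N x - _
  linarith

end

/-! ### Optimal power flow -/

section

variable {T : ℕ} {Gen Load Branch : Type*} [Fintype Gen] (P : Grid T Gen Load Branch)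

/-- The derivative of the generation cost at `z` in the direction `d`. -/
noncomputable def costDeriv (z : Primal T Gen Load) : Primal T Gen Load →ₗ[ℝ] ℝ where
  toFun d := ∑ t, ∑ i, (2 * P.c₂ i * z.1 t i + P.c₁ i) * d.1 t i
  map_add' d e := by
    simp only [← Finset.sum_add_distrib]
    exact Finset.sum_congr rfl fun t _ => Finset.sum_congr rfl fun i _ => by
      simp only [Prod.fst_add, Pi.add_apply]; ring
  map_smul' r d := by
    simp only [Finset.mul_sum, RingHom.id_apply, smul_eq_mul]
    exact Finset.sum_congr rfl fun t _ => Finset.sum_congr rfl fun i _ => by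
      simp only [Prod.smul_fst, Pi.smul_apply, smul_eq_mul]; ring

/-- The quadratic part of the generation cost. -/
def costQuad (d : Primal T Gen Load) : ℝ := ∑ t, ∑ i, P.c₂ i * d.1 t i ^ 2

theorem costQuad_nonneg (d : Primal T Gen Load) : 0 ≤ costQuad P d :=
  Finset.sum_nonneg fun t _ => Finset.sum_nonneg fun i _ => by have := P.c₂_pos i; positivity

/-- The expansion is exact, so it supplies both the first-order conditions and the convexity
inequality for the cost. -/
theorem cost_add_smul (z d : Primal T Gen Load) (r : ℝ) :
    cost P (z + r • d) = cost P z + r * costDeriv P z d + r ^ 2 * costQuad P d := by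
  simp only [cost, costDeriv, costQuad, LinearMap.coe_mk, AddHom.coe_mk, Finset.mul_sum,
    ← Finset.sum_add_distrib]
  exact Finset.sum_congr rfl fun t _ => Finset.sum_congr rfl fun i _ => by
    simp only [Prod.fst_add, Prod.smul_fst, Pi.add_apply, Pi.smul_apply, smul_eq_mul]; ring

/-- The generation cost as a function of the generations only. -/
def generationCost (g : Fin T → Gen → ℝ) : ℝ :=
  ∑ t, ∑ i, (P.c₂ i * g t i ^ 2 + P.c₁ i * g t i)

theorem cost_eq (z : Primal T Gen Load) : cost P z = generationCost P z.1 := rfl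

theorem continuous_generationCost : Continuous (generationCost P) := by
  unfold generationCost; fun_prop

variable [Fintype Load] [Fintype Branch]

/-- The left-hand side of a constraint as a linear map. -/
noncomputable def lhsₗ (c : Constraint T Gen Load Branch) : Primal T Gen Load →ₗ[ℝ] ℝ where
  toFun := lhs P c
  map_add' z w := by
    cases c with
    | balance t v =>
      simp [lhs, Matrix.mulVec_add]; rcases v with v | v <;> simp; ring
    | slack t => rfl
    | genUpper t i => rfl
    | genLower t i => simp [lhs]; ring
    | lineUpper t e => simp [lhs, Matrix.mulVec_add]
    | lineLower t e => simp [lhs, Matrix.mulVec_add]; ring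
  map_smul' r z := by
    cases c with
    | balance t v =>
      rcases v with v | v
      · simp [lhs, Matrix.mulVec_smul]; ring
      · simp [lhs, Matrix.mulVec_smul]
    | slack t => rfl
    | genUpper t i => rfl
    | genLower t i => simp [lhs]
    | lineUpper t e => simp [lhs, Matrix.mulVec_smul]
    | lineLower t e => simp [lhs, Matrix.mulVec_smul]

theorem lhs_add (c : Constraint T Gen Load Branch) (z w : Primal T Gen Load) :
    lhs P c (z + w) = lhs P c z + lhs P c w := (lhsₗ P c).map_add z w

theorem lhs_smul (c : Constraint T Gen Load Branch) (r : ℝ) (z : Primal T Gen Load) :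
    lhs P c (r • z) = r * lhs P c z := (lhsₗ P c).map_smul r z

theorem lhs_neg (c : Constraint T Gen Load Branch) (z : Primal T Gen Load) :
    lhs P c (-z) = -lhs P c z := (lhsₗ P c).map_neg z

theorem lhs_sub (c : Constraint T Gen Load Branch) (z w : Primal T Gen Load) :
    lhs P c (z - w) = lhs P c z - lhs P c w := (lhsₗ P c).map_sub z w

variable {P}

/-! ### Multipliers and subgradients -/

/-- Independent active constraints admit dual directions. -/
theorem exists_dual_direction {S : Set (Constraint T Gen Load Branch)}
    (hS : LinearIndependent ℝ (fun c : S => lhs P c.1)) :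
    ∃ d : Constraint T Gen Load Branch → Primal T Gen Load, ∀ c ∈ S,
      lhs P c (d c) = 1 ∧ ∀ c' ∈ S, c' ≠ c → lhs P c' (d c) = 0 := by
  classical
  have hS' : LinearIndependent ℝ (fun c : S => lhsₗ P c.1) := by
    refine LinearIndependent.of_comp (LinearMap.ltoFun ℝ (Primal T Gen Load) ℝ ℝ) ?_
    exact hS
  have key : ∀ c : Constraint T Gen Load Branch, ∃ d : Primal T Gen Load, c ∈ S →
      (lhs P c d = 1 ∧ ∀ c' ∈ S, c' ≠ c → lhs P c' d = 0) := by
    intro c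
    by_cases hc : c ∈ S
    swap
    · exact ⟨0, fun h => absurd h hc⟩
    have hn := linearIndependent_iff_notMem_span.1 hS' ⟨c, hc⟩
    have : ∃ d : Primal T Gen Load, lhs P c d ≠ 0 ∧ ∀ c' ∈ S, c' ≠ c → lhs P c' d = 0 := by
      by_contra! h
      apply hn
      -- If every direction killed by the other active constraints were killed by `c`, then `c`
      -- would lie in their span, against independence.
      have hspan : lhsₗ P c ∈ Submodule.span ℝ
          (Set.range fun c' : {c' : Constraint T Gen Load Branch // c' ∈ S ∧ c' ≠ c} =>
            lhsₗ P c'.1) := by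
        refine mem_span_of_iInf_ker_le_ker fun d hd => ?_
        rw [Submodule.mem_iInf] at hd
        by_contra hne
        obtain ⟨c', hc', hcc, hz⟩ := h d hne
        exact hz (hd ⟨c', hc', hcc⟩)
      refine Submodule.span_mono ?_ hspan
      rintro _ ⟨⟨c', hc', hcc⟩, rfl⟩
      exact ⟨⟨c', hc'⟩, ⟨trivial, fun h => hcc (congrArg Subtype.val h)⟩, rfl⟩
    obtain ⟨d, hd, hd'⟩ := this
    refine ⟨(lhs P c d)⁻¹ • d, fun _ => ⟨?_, fun c' hc' hcc => ?_⟩⟩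
    · rw [lhs_smul, inv_mul_cancel₀ hd]
    · rw [lhs_smul, hd' c' hc' hcc, mul_zero]
  choose d hd using key
  exact ⟨d, fun c hc => hd c hc⟩

/-- The change of the loads along a direction that keeps the power balance. -/
noncomputable def loadDirection (P : Grid T Gen Load Branch) (d : Primal T Gen Load) :
    Fin T × Load → ℝ :=
  fun j => -lhs P (Constraint.balance j.1 (Sum.inr j.2)) d

/-- Inactive inequalities keep their slack for short steps, active ones do not increase, and any
imbalance at a load bus is absorbed by changing the load. -/
theorem IsFeasible.eventually_add_smul {l : Fin T × Load → ℝ} {z d : Primal T Gen Load}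
    (hz : IsFeasible P l z)
    (hbal : ∀ t i, lhs P (Constraint.balance t (Sum.inl i)) d = 0)
    (hslack : ∀ t, lhs P (Constraint.slack t) d = 0)
    (hineq : ∀ c : Constraint T Gen Load Branch, ¬ c.IsEquality → c ∈ activeSet P l z →
      lhs P c d ≤ 0) :
    ∀ᶠ r : ℝ in 𝓝[>] 0, IsFeasible P (l + r • loadDirection P d) (z + r • d) := by
  have hrhs : ∀ (r : ℝ) (c : Constraint T Gen Load Branch), ¬ c.IsEquality →
      rhs P (l + r • loadDirection P d) c = rhs P l c := by
    intro r c hc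
    cases c <;> first | rfl | exact absurd trivial hc
  have h1 : ∀ c : Constraint T Gen Load Branch, ∀ᶠ r : ℝ in 𝓝[>] 0, ¬ c.IsEquality →
      lhs P c (z + r • d) ≤ rhs P l c := by
    intro c
    by_cases hc : c.IsEquality
    · exact Eventually.of_forall fun r h => absurd hc h
    by_cases ha : c ∈ activeSet P l z
    · filter_upwards [self_mem_nhdsWithin] with r hr _
      rw [lhs_add, lhs_smul]
      have h2 : lhs P c z = rhs P l c := ha
      have := mul_nonpos_of_nonneg_of_nonpos (le_of_lt hr) (hineq c hc ha)
      linarith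
    · have hlt : lhs P c z < rhs P l c := lt_of_le_of_ne (hz.2 c hc) ha
      have hcont : Continuous fun r : ℝ => lhs P c z + r * lhs P c d := by fun_prop
      have := (hcont.tendsto 0).eventually_lt_const (u := rhs P l c) (by simpa using hlt)
      filter_upwards [nhdsWithin_le_nhds this] with r hr _
      rw [lhs_add, lhs_smul]; exact hr.le
  filter_upwards [eventually_all.2 h1] with r hr
  refine ⟨fun c hc => ?_, fun c hc => by rw [hrhs r c hc]; exact hr c hc⟩
  have h0 := hz.1 c hc
  rw [lhs_add, lhs_smul, h0]
  cases c with
  | balance t v =>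
    rcases v with i | k
    · rw [hbal t i]; simp [rhs]
    · simp [rhs, loadDirection]; ring
  | slack t => rw [hslack t]; simp [rhs]
  | _ => exact absurd hc (by simp [Constraint.IsEquality])

/-- First order optimality for the cost minus the value of the loads at prices `p`, along feasible
directions. -/
theorem costDeriv_nonneg_of_minimizes {l p : Fin T × Load → ℝ} {z d : Primal T Gen Load}
    (hz : IsFeasible P l z)
    (hbal : ∀ t i, lhs P (Constraint.balance t (Sum.inl i)) d = 0)
    (hslack : ∀ t, lhs P (Constraint.slack t) d = 0)
    (hineq : ∀ c : Constraint T Gen Load Branch, ¬ c.IsEquality → c ∈ activeSet P l z →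
      lhs P c d ≤ 0)
    (hmin : ∀ r : ℝ, IsFeasible P (l + r • loadDirection P d) (z + r • d) →
      cost P z - p ⬝ᵥ l ≤ cost P (z + r • d) - p ⬝ᵥ (l + r • loadDirection P d)) :
    p ⬝ᵥ loadDirection P d ≤ costDeriv P z d := by
  have hlim : Tendsto (fun r : ℝ => costDeriv P z d - p ⬝ᵥ loadDirection P d + r * costQuad P d)
      (𝓝[>] 0) (𝓝 (costDeriv P z d - p ⬝ᵥ loadDirection P d)) := by
    have : Continuous fun r : ℝ =>
      costDeriv P z d - p ⬝ᵥ loadDirection P d + r * costQuad P d := by fun_prop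
    have h := this.tendsto 0
    simp only [zero_mul, add_zero] at h
    exact h.mono_left nhdsWithin_le_nhds
  have := ge_of_tendsto hlim (b := 0) ?_
  · linarith
  filter_upwards [hz.eventually_add_smul hbal hslack hineq, self_mem_nhdsWithin] with r hr hr0
  have h := hmin r hr
  rw [cost_add_smul, dotProduct_add, dotProduct_smul, smul_eq_mul] at h
  refine le_of_mul_le_mul_left ?_ (Set.mem_Ioi.1 hr0)
  rw [mul_zero]
  linarith

theorem IsFeasible.mem_activeSet {l : Fin T × Load → ℝ} {z : Primal T Gen Load}
    (hz : IsFeasible P l z) {c : Constraint T Gen Load Branch} (hc : c.IsEquality) :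
    c ∈ activeSet P l z := hz.1 c hc

/-- Optimal solutions with linearly independent active constraints have optimal dual variables. -/
theorem IsOptimal.exists_isPrimalDualOptimal {l : Fin T × Load → ℝ} {z : Primal T Gen Load}
    (hz : IsOptimal P l z)
    (hS : LinearIndependent ℝ (fun c : activeSet P l z => lhs P c.1)) :
    ∃ y, IsPrimalDualOptimal P l z y := by
  classical
  obtain ⟨d, hd⟩ := exists_dual_direction hS
  have hfirst : ∀ e : Primal T Gen Load,
      (∀ c : Constraint T Gen Load Branch, c.IsEquality → lhs P c e = 0) →
      (∀ c : Constraint T Gen Load Branch, ¬ c.IsEquality → c ∈ activeSet P l z →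
        lhs P c e ≤ 0) → 0 ≤ costDeriv P z e := by
    intro e he hi
    have hl : loadDirection P e = 0 := by
      funext j; simp [loadDirection, he (Constraint.balance j.1 (Sum.inr j.2)) trivial]
    have := costDeriv_nonneg_of_minimizes (p := 0) hz.1 (fun t i => he _ trivial)
      (fun t => he _ trivial) hi fun r hr => by
        rw [hl, smul_zero, add_zero] at hr
        simpa using hz.2 _ hr
    simpa using this
  refine ⟨fun c => if c ∈ activeSet P l z then -costDeriv P z (d c) else 0, hz, ?_, ?_, ?_⟩
  · intro c hc
    split_ifs with hcS
    · rw [← map_neg]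
      refine hfirst _ (fun c' hc' => ?_) fun c' _ hcS' => ?_
      · rw [lhs_neg, (hd c hcS).2 c' (hz.1.mem_activeSet hc') (by rintro rfl; exact hc hc'),
          neg_zero]
      · rw [lhs_neg]
        by_cases h : c' = c
        · rw [h, (hd c hcS).1]; norm_num
        · rw [(hd c hcS).2 c' hcS' h, neg_zero]
    · exact le_rfl
  · intro c
    split_ifs with hcS
    · have : lhs P c z = rhs P l c := hcS
      rw [this, sub_self, mul_zero]
    · rw [zero_mul]
  · intro e
    -- Removing the components of `e` along the dual directions leaves a vector on which all active
    -- constraints vanish. Both `e'` and `-e'` are then admissible, so the cost derivative vanishes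
    -- there.
    set e' : Primal T Gen Load :=
      e - ∑ c, if c ∈ activeSet P l z then lhs P c e • d c else 0 with he'
    have hzero : ∀ c ∈ activeSet P l z, lhs P c e' = 0 := by
      intro c hc
      rw [he', lhs_sub]
      have h1 : lhs P c (∑ c', if c' ∈ activeSet P l z then lhs P c' e • d c' else 0) =
          ∑ c', lhs P c (if c' ∈ activeSet P l z then lhs P c' e • d c' else 0) :=
        map_sum (lhsₗ P c) _ _
      rw [h1, Finset.sum_eq_single c]
      · rw [if_pos hc, lhs_smul, (hd c hc).1, mul_one, sub_self]
      · intro c' _ hne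
        split_ifs with hc'
        · rw [lhs_smul, (hd c' hc').2 c hc hne.symm, mul_zero]
        · exact (lhsₗ P c).map_zero
      · exact fun h => absurd (Finset.mem_univ c) h
    have h1 := hfirst e' (fun c hc => hzero c (hz.1.mem_activeSet hc))
      fun c _ hc => (hzero c hc).le
    have h2 := hfirst (-e') (fun c hc => by
        rw [lhs_neg, hzero c (hz.1.mem_activeSet hc), neg_zero])
      fun c _ hc => by rw [lhs_neg, hzero c hc, neg_zero]
    rw [map_neg] at h2
    have h3 : costDeriv P z e' = 0 := by linarith
    rw [he', map_sub, map_sum] at h3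
    change costDeriv P z e + _ = 0
    refine Eq.trans ?_ h3
    rw [sub_eq_add_neg, ← Finset.sum_neg_distrib]
    congr 1
    refine Finset.sum_congr rfl fun c _ => ?_
    split_ifs
    · rw [map_smul, smul_eq_mul]; ring
    · simp

/-- Optimal dual variables of the load balances are subgradients of the optimal cost with respect to
the loads. -/
theorem IsPrimalDualOptimal.cost_ge {l : Fin T × Load → ℝ} {z : Primal T Gen Load}
    {y : Constraint T Gen Load Branch → ℝ} (h : IsPrimalDualOptimal P l z y)
    {l' : Fin T × Load → ℝ} {z' : Primal T Gen Load} (hz' : IsFeasible P l' z') :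
    cost P z + (fun j : Fin T × Load => y (Constraint.balance j.1 (Sum.inr j.2))) ⬝ᵥ (l' - l) ≤
      cost P z' := by
  have hcost := cost_add_smul P z (z' - z) 1
  rw [one_smul, add_sub_cancel] at hcost
  have hq := costQuad_nonneg P (z' - z)
  have hst : costDeriv P z (z' - z) + ∑ c, y c * lhs P c (z' - z) = 0 := h.stationary (z' - z)
  have hle : ∑ c, y c * lhs P c (z' - z) ≤ ∑ c, y c * (rhs P l' c - rhs P l c) := by
    refine Finset.sum_le_sum fun c _ => ?_
    have hs := h.slackness c
    rw [lhs_sub]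
    by_cases hc : c.IsEquality
    · have := hz'.1 c hc
      rw [this]; linarith
    · have := mul_le_mul_of_nonneg_left (hz'.2 c hc) (h.nonneg c hc)
      linarith
  -- Only the right-hand sides of the load balances depend on the loads, and they equal `-l`; hence
  -- the sign.
  have hsum : ∑ c, y c * (rhs P l' c - rhs P l c) =
      -((fun j : Fin T × Load => y (Constraint.balance j.1 (Sum.inr j.2))) ⬝ᵥ (l' - l)) := by
    rw [← dotProduct_neg]
    refine (Fintype.sum_of_injective
      (fun j : Fin T × Load => (Constraint.balance j.1 (Sum.inr j.2) :
        Constraint T Gen Load Branch)) ?_ _ _ ?_ ?_).symm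
    · rintro ⟨t, k⟩ ⟨t', k'⟩ hj
      simpa using hj
    · intro c hc
      cases c with
      | balance t v =>
        rcases v with i | k
        · simp [rhs]
        · exact absurd ⟨(t, k), rfl⟩ hc
      | _ => simp [rhs]
    · rintro ⟨t, k⟩
      simp [rhs]
      ring_nf
      simp
  linarith

/-- With linearly independent active constraints, prices at which the optimal solution maximizes
the value of the loads minus the cost are the optimal dual variables of the load balances. -/
theorem IsPrimalDualOptimal.eq_of_minimizes {l : Fin T × Load → ℝ} {z : Primal T Gen Load}
    {y : Constraint T Gen Load Branch → ℝ} (h : IsPrimalDualOptimal P l z y)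
    (hS : LinearIndependent ℝ (fun c : activeSet P l z => lhs P c.1))
    {p : Fin T × Load → ℝ}
    (hp : ∀ l' z', IsFeasible P l' z' → cost P z - p ⬝ᵥ l ≤ cost P z' - p ⬝ᵥ l')
    (t : Fin T) (k : Load) : p (t, k) = y (Constraint.balance t (Sum.inr k)) := by
  classical
  obtain ⟨d, hd⟩ := exists_dual_direction hS
  have hz := h.optimal.1
  set c₀ : Constraint T Gen Load Branch := Constraint.balance t (Sum.inr k) with hc₀def
  have hc₀ : c₀ ∈ activeSet P l z := hz.mem_activeSet trivial
  obtain ⟨hd1, hd0⟩ := hd c₀ hc₀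
  -- The dual direction of this balance constraint lowers the load `(t, k)` by one and changes no
  -- other load. Testing it with both signs pins down the price.
  have hload : p ⬝ᵥ loadDirection P (d c₀) = -p (t, k) := by
    rw [dotProduct, Finset.sum_eq_single (t, k)]
    · simp only [loadDirection]
      rw [← hc₀def, hd1]; ring
    · rintro ⟨t', k'⟩ - hne
      have : lhs P (Constraint.balance t' (Sum.inr k')) (d c₀) = 0 := by
        refine hd0 _ (hz.mem_activeSet trivial) ?_
        intro he
        apply hne
        simp only [hc₀def, Constraint.balance.injEq, Sum.inr.injEq] at he
        simp [he]
      simp [loadDirection, this]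
    · exact fun hn => absurd (Finset.mem_univ _) hn
  have hbal : ∀ t i, lhs P (Constraint.balance t (Sum.inl i)) (d c₀) = 0 := fun t i =>
    hd0 _ (hz.mem_activeSet trivial) (by simp [hc₀def])
  have hslack : ∀ t, lhs P (Constraint.slack t) (d c₀) = 0 := fun t =>
    hd0 _ (hz.mem_activeSet trivial) (by simp [hc₀def])
  have hineq : ∀ c : Constraint T Gen Load Branch, ¬ c.IsEquality → c ∈ activeSet P l z →
      lhs P c (d c₀) = 0 := fun c hc hcS => hd0 _ hcS (by rintro rfl; exact hc trivial)
  have h1 := costDeriv_nonneg_of_minimizes (p := p) hz hbal hslack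
    (fun c hc hcS => (hineq c hc hcS).le) fun r hr => hp _ _ hr
  have hneg : loadDirection P (-d c₀) = -loadDirection P (d c₀) := by
    funext j; simp [loadDirection, lhs_neg]
  have h2 := costDeriv_nonneg_of_minimizes (p := p) (d := -d c₀) hz
    (fun t i => by rw [lhs_neg, hbal, neg_zero]) (fun t => by rw [lhs_neg, hslack, neg_zero])
    (fun c hc hcS => by rw [lhs_neg, hineq c hc hcS, neg_zero]) fun r hr => hp _ _ hr
  rw [hneg, dotProduct_neg, map_neg, hload] at h2
  rw [hload] at h1
  have hst : costDeriv P z (d c₀) + ∑ c, y c * lhs P c (d c₀) = 0 := h.stationary (d c₀)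
  rw [Finset.sum_eq_single c₀, hd1] at hst
  · linarith
  · intro c _ hne
    by_cases hcS : c ∈ activeSet P l z
    · rw [hd0 c hcS hne, mul_zero]
    · have : y c = 0 :=
        (mul_eq_zero.1 (h.slackness c)).resolve_right fun h0 => hcS (sub_eq_zero.1 h0)
      rw [this, zero_mul]
  · exact fun hn => absurd (Finset.mem_univ _) hn

/-! ### Compactness of the feasible loads and generations -/

variable (P)

/-- Loads and generations that are feasible with some voltage angles. -/
def feasibleSupply : Set ((Fin T × Load → ℝ) × (Fin T → Gen → ℝ)) :=
  {x | ∃ θ, IsFeasible P x.1 (x.2, θ)}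

theorem isCompact_feasibleSupply : IsCompact (feasibleSupply P) := by
  let V : Submodule ℝ (Fin T → Gen ⊕ Load → ℝ) :=
    { carrier := {θ | ∀ t, θ t (Sum.inl P.slack) = 0}
      add_mem' := fun {a b} ha hb t => by simp [ha t, hb t]
      zero_mem' := fun t => rfl
      smul_mem' := fun r a ha t => by simp [ha t] }
  -- Angles need not be bounded by the constraints, but line flows are. So supplies are parametrized
  -- by flows: `Φ` maps angles to flows, whose range over slack-normalized angles is a closed
  -- subspace, and `Ψ` reads off loads and generations.
  let Φ : (Fin T → Gen ⊕ Load → ℝ) →ₗ[ℝ] (Fin T → Branch → ℝ) :=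
    { toFun := fun θ t => (flowMatrix P).mulVec (θ t)
      map_add' := fun a b => by funext t; simp [Matrix.mulVec_add]
      map_smul' := fun r a => by funext t; simp [Matrix.mulVec_smul] }
  let Ψ : (Fin T → Branch → ℝ) → (Fin T × Load → ℝ) × (Fin T → Gen → ℝ) := fun f =>
    (fun j => -(busBranch P).mulVec (f j.1) (Sum.inr j.2),
      fun t i => (busBranch P).mulVec (f t) (Sum.inl i))
  have hA : ∀ t v, Continuous fun f : Fin T → Branch → ℝ => (busBranch P).mulVec (f t) v := by
    intro t v
    unfold Matrix.mulVec dotProduct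
    fun_prop
  have hΨ : Continuous Ψ := by
    refine Continuous.prodMk ?_ ?_
    · exact continuous_pi fun j => (hA _ _).neg
    · exact continuous_pi fun t => continuous_pi fun i => hA _ _
  let K : Set (Fin T → Branch → ℝ) := Set.Icc (fun _ => P.fmin) (fun _ => P.fmax) ∩
    ((V.map Φ : Set (Fin T → Branch → ℝ)) ∩
      {f | (fun _ => P.gmin) ≤ (Ψ f).2 ∧ (Ψ f).2 ≤ fun _ => P.gmax})
  have hK : IsCompact K := by
    refine isCompact_Icc.inter_right (IsClosed.inter ?_ ?_)
    · exact (V.map Φ).closed_of_finiteDimensional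
    · exact (isClosed_le continuous_const (continuous_snd.comp hΨ)).inter
        (isClosed_le (continuous_snd.comp hΨ) continuous_const)
  have himage : feasibleSupply P = Ψ '' K := by
    ext ⟨l, g⟩
    constructor
    · rintro ⟨θ, hθ⟩
      have hg : (Ψ (Φ θ)).2 = g := by
        funext t i
        have := hθ.1 (Constraint.balance t (Sum.inl i)) trivial
        simp only [lhs, rhs, Sum.elim_inl, Pi.zero_apply, ← Matrix.mulVec_mulVec] at this
        simpa [Ψ, Φ] using sub_eq_zero.1 this
      refine ⟨Φ θ, ⟨⟨fun t e => ?_, fun t e => ?_⟩, ⟨θ, fun t => ?_, rfl⟩, ?_, ?_⟩, ?_⟩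
      · have := hθ.2 (Constraint.lineLower t e) not_false
        simp only [lhs, rhs, neg_le_neg_iff] at this
        exact this
      · exact hθ.2 (Constraint.lineUpper t e) not_false
      · exact hθ.1 (Constraint.slack t) trivial
      · intro t i
        rw [hg]
        have := hθ.2 (Constraint.genLower t i) not_false
        simpa [lhs, rhs] using this
      · intro t i
        rw [hg]
        exact hθ.2 (Constraint.genUpper t i) not_false
      · refine Prod.ext ?_ hg
        funext ⟨t, k⟩
        have := hθ.1 (Constraint.balance t (Sum.inr k)) trivial
        simp only [lhs, rhs, Sum.elim_inr, Pi.zero_apply, sub_zero, ← Matrix.mulVec_mulVec] at this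
        simp [Ψ, Φ, this]
    · rintro ⟨f, ⟨hf, ⟨θ, hθ, rfl⟩, hg1, hg2⟩, he⟩
      obtain ⟨rfl, rfl⟩ := Prod.ext_iff.1 he
      refine ⟨θ, fun c hc => ?_, fun c hc => ?_⟩
      · cases c with
        | balance t v =>
          rcases v with i | k <;> simp [lhs, rhs, Ψ, Φ, ← Matrix.mulVec_mulVec]
        | slack t => exact hθ t
        | _ => exact absurd hc (by simp [Constraint.IsEquality])
      · cases c with
        | genUpper t i => exact hg2 t i
        | genLower t i => exact neg_le_neg (hg1 t i)
        | lineUpper t e => exact hf.2 t e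
        | lineLower t e => exact neg_le_neg (hf.1 t e)
        | _ => exact absurd trivial hc
  rw [himage]
  exact hK.image hΨ

variable {P}

/-- The cost depends on the generations alone, so it suffices to minimize over a closed slice of the
compact set of supplies; the angles are recovered afterwards. -/
theorem exists_isOptimal {l : Fin T × Load → ℝ} (h : ∃ z, IsFeasible P l z) :
    ∃ z, IsOptimal P l z := by
  have hK : IsCompact (feasibleSupply P ∩ {x | x.1 = l}) :=
    (isCompact_feasibleSupply P).inter_right (isClosed_eq continuous_fst continuous_const)
  obtain ⟨⟨g, θ⟩, hz⟩ := h
  obtain ⟨⟨l', g'⟩, ⟨⟨θ', hθ'⟩, hl⟩, hmin⟩ := hK.exists_isMinOn ⟨(l, g), ⟨θ, hz⟩, rfl⟩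
    ((continuous_generationCost P).comp continuous_snd).continuousOn
  obtain rfl : l' = l := hl
  refine ⟨(g', θ'), hθ', fun z hz => ?_⟩
  have hle : generationCost P g' ≤ generationCost P z.1 :=
    isMinOn_iff.1 hmin (l', z.1) ⟨⟨z.2, hz⟩, rfl⟩
  exact hle

end

/-! ### Equilibrium prices -/

section

variable {T : ℕ} {Zone Gen Load Branch : Type*} [Fintype Zone] [Fintype Gen] [Fintype Load]
  [Fintype Branch] {N : Logistics T Zone Load} {P : Grid T Gen Load Branch}
  {F : (s : State N) → (Act s → ℝ) → ℝ}
  {D : PartialEquiv (DemandIndex N → ℝ) (DemandIndex N → ℝ)}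

/-- At a regular charging flow the locational marginal prices come with an optimal primal-dual pair
whose active constraints are linearly independent. -/
theorem IsRegularAt.exists_isLMP {xC : ChargingAction N → ℝ} (h : IsRegularAt P xC) :
    ∃ q, IsLMP P (totalLoad P xC) q := by
  obtain ⟨X, -, hxC, S, hS, hX⟩ := h
  obtain ⟨hfeas, hact⟩ := hX xC hxC
  obtain ⟨z, hz⟩ := exists_isOptimal hfeas
  obtain rfl := hact z hz
  obtain ⟨y, hy⟩ := hz.exists_isPrimalDualOptimal hS
  exact ⟨fun j => y (Constraint.balance j.1 (Sum.inr j.2)), z, y, hy, fun _ _ => rfl⟩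

theorem IsRegularAt.linearIndependent {xC : ChargingAction N → ℝ} (h : IsRegularAt P xC)
    {z : Primal T Gen Load} (hz : IsOptimal P (totalLoad P xC) z) :
    LinearIndependent ℝ (fun c : activeSet P (totalLoad P xC) z => lhs P c.1) := by
  obtain ⟨X, -, hxC, S, hS, hX⟩ := h
  obtain rfl := (hX xC hxC).2 z hz
  exact hS

/-- The multipliers may come with another optimal solution `w`, but only its cost enters, and all
optimal solutions share it. -/
theorem IsLMP.cost_ge {l q : Fin T × Load → ℝ} (h : IsLMP P l q) {z : Primal T Gen Load}
    (hz : IsOptimal P l z) {l' : Fin T × Load → ℝ} {z' : Primal T Gen Load}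
    (hz' : IsFeasible P l' z') : cost P z + q ⬝ᵥ (l' - l) ≤ cost P z' := by
  obtain ⟨w, y, hy, hq⟩ := h
  have hq' : q = fun j : Fin T × Load => y (Constraint.balance j.1 (Sum.inr j.2)) :=
    funext fun j => hq j.1 j.2
  have h1 := hy.cost_ge hz'
  have h2 := hz.2 w hy.optimal.1
  rw [← hq'] at h1
  linarith

/-- Prices that support an optimal solution with linearly independent active constraints are the
locational marginal prices. -/
theorem IsLMP.eq_of_minimizes {l p q : Fin T × Load → ℝ} (h : IsLMP P l q)
    (hS : ∀ z, IsOptimal P l z →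
      LinearIndependent ℝ (fun c : activeSet P l z => lhs P c.1))
    (hp : ∀ z, IsOptimal P l z → ∀ l' z', IsFeasible P l' z' →
      cost P z - p ⬝ᵥ l ≤ cost P z' - p ⬝ᵥ l') : p = q := by
  obtain ⟨z, y, hy, hq⟩ := h
  funext ⟨t, k⟩
  rw [hq t k]
  exact hy.eq_of_minimizes (hS z hy.optimal) (hp z hy.optimal) t k

/-- A marginal price is a subgradient of the optimal cost, hence supports every optimal solution,
and a supporting price must equal any other marginal price. -/
theorem IsRegularAt.isLMP_unique {xC : ChargingAction N → ℝ} (h : IsRegularAt P xC)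
    {q q' : Fin T × Load → ℝ} (hq : IsLMP P (totalLoad P xC) q)
    (hq' : IsLMP P (totalLoad P xC) q') : q = q' := by
  refine hq'.eq_of_minimizes (fun z hz => h.linearIndependent hz) fun z hz l' z' hz' => ?_
  have := hq.cost_ge hz hz'
  rw [dotProduct_sub] at this
  linarith

theorem IsOptimalChargingFlow.eq (hF : ∀ s, IsPerturbation (F s))
    (hDc : ConcaveOn ℝ {z : DemandIndex N → ℝ | 0 ≤ z} fun z => D.symm z ⬝ᵥ z)
    {p : Fin T × Load → ℝ} {xC : ChargingAction N → ℝ} (h : IsOptimalChargingFlow F D p xC)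
    {x : StateAction N} (hx : IsSystemOptimal F D p x) : xC = chargingFlow x := by
  obtain ⟨μD, μC, x', hx', rfl⟩ := h
  rw [hx'.systemOptimal.unique hF hDc hx]

theorem IsSystemOptimal.isOptimalChargingFlow (hF : ∀ s, IsPerturbation (F s))
    (hD : ∀ z, 0 ≤ z → DifferentiableAt ℝ D.symm z)
    {p : Fin T × Load → ℝ} {x : StateAction N} (hx : IsSystemOptimal F D p x) :
    IsOptimalChargingFlow F D p (chargingFlow x) := by
  obtain ⟨μD, μC, h⟩ := hx.exists_isOptimalReward hF hD
  exact ⟨μD, μC, x, h, rfl⟩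

theorem existsUnique_isPriceResponse (hF : ∀ s, IsPerturbation (F s))
    (hD : ∀ z, 0 ≤ z → DifferentiableAt ℝ D.symm z)
    (hDc : ConcaveOn ℝ {z : DemandIndex N → ℝ | 0 ≤ z} fun z => D.symm z ⬝ᵥ z)
    {p : Fin T × Load → ℝ}
    (hreg : ∀ xC : ChargingAction N → ℝ, IsOptimalChargingFlow F D p xC → IsRegularAt P xC) :
    ∃! q, IsPriceResponse P F D p q := by
  obtain ⟨x, hx⟩ := exists_isSystemOptimal hF hD hDc p
  have hxC := hx.isOptimalChargingFlow hF hD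
  obtain ⟨q, hq⟩ := (hreg _ hxC).exists_isLMP
  refine ⟨q, ⟨_, hxC, hq⟩, ?_⟩
  rintro q' ⟨xC, hxC', hq'⟩
  rw [hxC'.eq hF hDc hx] at hq'
  exact (hreg _ hxC).isLMP_unique hq' hq

/-! ### The potential and its minimizer -/

/-- A minimizer `p` of a pointwise maximum of affine functions over a convex set, tested along the
segment to `q`: maximizers at the nearby prices have nonnegative slope in the direction `q - p`. -/
theorem exists_minimizer_of_affine_max {ι A : Type*} [Fintype ι] {Pi : Set (ι → ℝ)}
    (hne : Pi.Nonempty) (hcomp : IsCompact Pi) (hconv : Convex ℝ Pi) (a : A → ℝ) (b : A → ι → ℝ)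
    (α : (ι → ℝ) → A) (hα : ∀ p β, a β + p ⬝ᵥ b β ≤ a (α p) + p ⬝ᵥ b (α p)) :
    ∃ p ∈ Pi, ∀ q ∈ Pi, ∀ r : ℝ, 0 < r → r ≤ 1 → 0 ≤ (q - p) ⬝ᵥ b (α (p + r • (q - p))) := by
  -- An upper envelope of affine functions is lower semicontinuous, which suffices for a minimum on
  -- a compact set.
  have hlsc : LowerSemicontinuousOn (fun p => a (α p) + p ⬝ᵥ b (α p)) Pi := by
    intro p₀ _ c hc
    have hcont : Continuous fun p : ι → ℝ => a (α p₀) + p ⬝ᵥ b (α p₀) :=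
      continuous_const.add (continuous_id.dotProduct continuous_const)
    filter_upwards [nhdsWithin_le_nhds ((hcont.tendsto p₀).eventually_const_lt hc)] with p hp
    exact lt_of_lt_of_le hp (hα p (α p₀))
  obtain ⟨p, hp, hmin⟩ := hlsc.exists_isMinOn hne hcomp
  refine ⟨p, hp, fun q hq r h0 h1 => ?_⟩
  have hmem : p + r • (q - p) ∈ Pi := hconv.add_smul_sub_mem hp hq ⟨h0.le, h1⟩
  have h2 := isMinOn_iff.1 hmin _ hmem
  -- The affine piece that is maximal at the nearby price lies below the envelope at `p`. Since the
  -- envelope does not decrease from `p`, this piece does not either.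
  have h3 := hα p (α (p + r • (q - p)))
  simp only [add_dotProduct, smul_dotProduct, smul_eq_mul] at h2 h3
  refine le_of_mul_le_mul_left ?_ h0
  rw [mul_zero]
  linarith

/-- The potential is minimized first; its optimality condition is then tested only in the direction
of the response `q` to the minimizer, which is admissible because `q` stays in the price set. -/
theorem exists_isPriceResponse_self (hF : ∀ s, IsPerturbation (F s))
    (hD : ∀ z, 0 ≤ z → DifferentiableAt ℝ D.symm z)
    (hDc : ConcaveOn ℝ {z : DemandIndex N → ℝ | 0 ≤ z} fun z => D.symm z ⬝ᵥ z)
    {Pi : Set (Fin T × Load → ℝ)} (hne : Pi.Nonempty) (hcomp : IsCompact Pi)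
    (hconv : Convex ℝ Pi)
    (hreg : ∀ p ∈ Pi, ∀ xC : ChargingAction N → ℝ,
      IsOptimalChargingFlow F D p xC → IsRegularAt P xC)
    (hmaps : ∀ p ∈ Pi, ∀ q, IsPriceResponse P F D p q → q ∈ Pi) :
    ∃ p ∈ Pi, IsPriceResponse P F D p p := by
  choose X hX using exists_isSystemOptimal hF hD hDc
  have hsupply : (feasibleSupply P).Nonempty := by
    obtain ⟨p, hp⟩ := hne
    obtain ⟨U, -, hU, S, -, hS⟩ := hreg p hp _ ((hX p).isOptimalChargingFlow hF hD)
    obtain ⟨z, hz⟩ := (hS _ hU).1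
    exact ⟨(_, z.1), z.2, hz⟩
  have hcontp : ∀ p : Fin T × Load → ℝ,
      Continuous fun w : (Fin T × Load → ℝ) × (Fin T → Gen → ℝ) =>
        p ⬝ᵥ w.1 - generationCost P w.2 := fun p =>
    (continuous_const.dotProduct continuous_fst).sub
      ((continuous_generationCost P).comp continuous_snd)
  have hW : ∀ p : Fin T × Load → ℝ, ∃ w ∈ feasibleSupply P, ∀ v ∈ feasibleSupply P,
      p ⬝ᵥ v.1 - generationCost P v.2 ≤ p ⬝ᵥ w.1 - generationCost P w.2 := fun p =>
    (isCompact_feasibleSupply P).exists_isMaxOn hsupply (hcontp p).continuousOn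
  choose W hWmem hWmax using hW
  have hφ : (0 : ℝ) < N.φ := by exact_mod_cast N.φ_pos
  -- The profit is scaled by `φ` so that its slope is minus the added load; an affine piece pairs a
  -- flow with a supply, and its slope is the excess supply.
  obtain ⟨p, hp, hslope⟩ := exists_minimizer_of_affine_max hne hcomp hconv
    (A := {x : StateAction N // InFlowDomain x} × feasibleSupply P)
    (fun β => N.φ * profit F D 0 β.1.1 - generationCost P β.2.1.2)
    (fun β => β.2.1.1 - totalLoad P (chargingFlow β.1.1))
    (fun p => (⟨X p, (hX p).1⟩, ⟨W p, hWmem p⟩)) (by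
      rintro p ⟨⟨x, hx⟩, ⟨w, hw⟩⟩
      have h1 := mul_le_mul_of_nonneg_left ((hX p).2 x hx) hφ.le
      have h2 := hWmax p w hw
      have e : ∀ x, profit F D p x = profit F D 0 x - p ⬝ᵥ chargingLoadₗ N x := fun x => by
        have := profit_sub_profit (F := F) (D := D) p 0 x
        rw [zero_sub, neg_dotProduct] at this
        linarith
      have e2 : ∀ x, totalLoad P (chargingFlow x) = P.l₀ + (N.φ : ℝ) • chargingLoadₗ N x :=
        fun _ => rfl
      rw [e, e] at h1
      simp only [e2, dotProduct_sub, dotProduct_add, dotProduct_smul, smul_eq_mul]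
      linarith)
  obtain ⟨q, hq, -⟩ := existsUnique_isPriceResponse hF hD hDc (hreg p hp)
  have hqPi := hmaps p hp q hq
  obtain ⟨xC, hxC, hlmp⟩ := hq
  have hregp := hreg p hp xC hxC
  -- Supply maximizers at `p` need not be unique, and an arbitrary one may have the wrong slope.
  -- Limits of maximizers along the segment towards `q` inherit the inequality.
  let r : ℕ → ℝ := fun n => 1 / ((n : ℝ) + 1)
  have hr0 : ∀ n, 0 < r n := fun n => Nat.one_div_pos_of_nat
  have hr1 : ∀ n, r n ≤ 1 := fun n => by
    simp only [r]
    rw [div_le_one (by positivity)]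
    have : (0 : ℝ) ≤ n := n.cast_nonneg
    linarith
  let pn : ℕ → Fin T × Load → ℝ := fun n => p + r n • (q - p)
  have hpn : Tendsto pn atTop (𝓝 p) := by
    have := (tendsto_one_div_add_atTop_nhds_zero_nat (𝕜 := ℝ)).smul_const (q - p)
    simpa [pn, r] using this.const_add p
  obtain ⟨x', φ, hx', hφm, hxlim⟩ := exists_tendsto_isSystemOptimal hF hD hDc hpn
    (fun n => hX (pn n))
  obtain ⟨w, hw, ψ, hψm, hwlim⟩ := (isCompact_feasibleSupply P).tendsto_subseq
    (fun n => hWmem (pn (φ n)))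
  have hpn' : Tendsto (fun n => pn (φ (ψ n))) atTop (𝓝 p) :=
    hpn.comp (hφm.tendsto_atTop.comp hψm.tendsto_atTop)
  have hxlim' : Tendsto (fun n => X (pn (φ (ψ n)))) atTop (𝓝 x') :=
    hxlim.comp hψm.tendsto_atTop
  replace hwlim : Tendsto (fun n => W (pn (φ (ψ n)))) atTop (𝓝 w) := hwlim
  have hwmax : ∀ v ∈ feasibleSupply P,
      p ⬝ᵥ v.1 - generationCost P v.2 ≤ p ⬝ᵥ w.1 - generationCost P w.2 := by
    intro v hv
    have hc : Continuous fun s : (Fin T × Load → ℝ) × (Fin T × Load → ℝ) × (Fin T → Gen → ℝ) =>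
        s.1 ⬝ᵥ s.2.1 - generationCost P s.2.2 :=
      (continuous_fst.dotProduct (continuous_fst.comp continuous_snd)).sub
        ((continuous_generationCost P).comp (continuous_snd.comp continuous_snd))
    have h1 := (hc.tendsto (p, v)).comp (hpn'.prodMk_nhds (tendsto_const_nhds (x := v)))
    have h2 := (hc.tendsto (p, w)).comp (hpn'.prodMk_nhds hwlim)
    exact le_of_tendsto_of_tendsto' h1 h2 fun n => hWmax _ v hv
  have hxx : xC = chargingFlow x' := hxC.eq hF hDc hx'
  have hdir : 0 ≤ (q - p) ⬝ᵥ (w.1 - totalLoad P xC) := by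
    have hc : Continuous fun s : (Fin T × Load → ℝ) × StateAction N =>
        (q - p) ⬝ᵥ (s.1 - totalLoad P (chargingFlow s.2)) := by
      have h1 := (chargingLoadₗ N).continuous_of_finiteDimensional
      have h2 : Continuous fun x : StateAction N => totalLoad P (chargingFlow x) :=
        continuous_const.add (h1.const_smul (N.φ : ℝ))
      exact continuous_const.dotProduct (continuous_fst.sub (h2.comp continuous_snd))
    have h1 := (hc.tendsto (w.1, x')).comp
      (((continuous_fst.tendsto w).comp hwlim).prodMk_nhds hxlim')
    rw [hxx]
    exact ge_of_tendsto' h1 fun n => hslope q hqPi _ (hr0 _) (hr1 _)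
  -- For any supply `(l', z')`, its surplus at `p` is at most that of `w`. The subgradient
  -- inequality for `q` and `hdir` bound the latter by the surplus of `z` at the actual loads, so
  -- `p` supports `z`.
  have hpq : p = q := by
    refine hlmp.eq_of_minimizes (fun z hz => hregp.linearIndependent hz) fun z hz l' z' hz' => ?_
    obtain ⟨θ, hθ⟩ := hw
    have h1 := hlmp.cost_ge hz hθ
    have h2 := hwmax (l', z'.1) ⟨z'.2, hz'⟩
    rw [cost_eq P (w.2, θ)] at h1
    rw [cost_eq P z']
    simp only at h1 h2
    rw [sub_dotProduct] at hdir
    have h3 : p ⬝ᵥ (w.1 - totalLoad P xC) = p ⬝ᵥ w.1 - p ⬝ᵥ totalLoad P xC := dotProduct_sub _ _ _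
    linarith
  exact ⟨p, hp, xC, hxC, hpq ▸ hlmp⟩

end

end EloPso

theorem proposition5 {T : ℕ} {Zone Gen Load Branch : Type*}
    [Fintype Zone] [Fintype Gen] [Fintype Load] [Fintype Branch]
    (N : EloPso.Logistics T Zone Load) (P : EloPso.Grid T Gen Load Branch)
    (F : (s : EloPso.State N) → (EloPso.Act s → ℝ) → ℝ)
    (hF : ∀ s, EloPso.IsPerturbation (F s))
    (D : PartialEquiv (EloPso.DemandIndex N → ℝ) (EloPso.DemandIndex N → ℝ))
    (hD : D.target = Set.univ)
    (hDdiff : ∀ z, 0 ≤ z → DifferentiableAt ℝ D.symm z)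
    (hDconc : ConcaveOn ℝ {z : EloPso.DemandIndex N → ℝ | 0 ≤ z} (fun z => D.symm z ⬝ᵥ z))
    (Pi : Set (Fin T × Load → ℝ))
    (hne : Pi.Nonempty) (hcomp : IsCompact Pi) (hconv : Convex ℝ Pi)
    (hreg : ∀ p ∈ Pi, ∀ xC : EloPso.ChargingAction N → ℝ,
      EloPso.IsOptimalChargingFlow F D p xC → EloPso.IsRegularAt P xC)
    (hmaps : ∀ p ∈ Pi, ∀ q, EloPso.IsPriceResponse P F D p q → q ∈ Pi) :
    (∀ p ∈ Pi, ∃! q, EloPso.IsPriceResponse P F D p q) ∧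
      ∃ p ∈ Pi, EloPso.IsPriceResponse P F D p p :=
  ⟨fun p hp => EloPso.existsUnique_isPriceResponse hF hDdiff hDconc (hreg p hp),
    EloPso.exists_isPriceResponse_self hF hDdiff hDconc hne hcomp hconv hreg hmaps⟩
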